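/- Let $M$ be a simple matroid (no loops and no parallel elements) on $[n]=\{1,\dots,n\}$ of rank $r\ge 2$, with set of bases $\mathcal B(M)$ and set of independent sets $\mathcal I(M)$. Let $$f_M=\sum_{B\in\mathcal B(M)}\ \prod_{i\in B}x_i,\qquad P_M=\sum_{I\in\mathcal I(M)}\Big(\prod_{i\in I}x_i\Big)x_0^{\,n-|I|},\qquad \overline P_M=\Big(\frac{\partial}{\partial x_0}\Big)^{n-r}P_M$$ be its basis generating polynomial, its independent set generating polynomial and its reduced independent set generating polynomial. For a polynomial $f$ let $H_f=(\partial_i\partial_j f)_{i,j}$ denote its Hessian matrix with respect to all its variables ($x_1,\dots,x_n$ for $f_M$; $x_0,x_1,\dots,x_n$ for $\overline P_M$). A real symmetric matrix has signature $(+,-,\dots,-)$ if it is non-singular with exactly one positive eigenvalue, counted with multiplicity. (i) For every $a\in\mathbb R_{>0}^n$ the matrix $H_{f_M}|_{x=a}$ has signature $(+,-,\dots,-)$. In particular $f_M$ is strictly log-concave on $\mathbb R_{>0}^n$, that is, $f_M>0$ there and $\log f_M$ is a strictly concave function on $\mathbb R_{>0}^n$. (ii) If $M$ is not a uniform matroid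 (that is, $\mathcal B(M)$ is not the set of all $r$-element subsets of $[n]$), then $H_{\overline P_M}|_{x=a}$ has signature $(+,-,\dots,-)$ for every $a=(a_0,a_1,\dots,a_n)\in\mathbb R^{n+1}$ with $a_0\ge 0$ and $a_1,\dots,a_n>0$. -/

import Mathlib

noncomputable section

/-- A matroid is simple if it has no loops and no parallel elements, i.e. no two distinct elements
forming a circuit. -/
def Matroid.IsSimple {α : Type*} (M : Matroid α) : Prop :=
  (∀ e : α, ¬ M.IsLoop e) ∧ ∀ e f : α, e ≠ f → ¬ M.IsCircuit {e, f}

/-- A matroid is uniform if its bases are exactly the `k`-element subsets of its ground set, for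
some `k`. -/
def Matroid.IsUniform {α : Type*} (M : Matroid α) : Prop :=
  ∃ k : ℕ, ∀ B : Set α, B ⊆ M.E → (M.IsBase B ↔ B.encard = k)

open Classical in
/-- The basis generating polynomial `∑_B ∏_{i ∈ B} x_i`, summed over the bases `B` of `M`. -/
def Matroid.basisPoly (R : Type*) [CommRing R] {n : ℕ} (M : Matroid (Fin n)) :
    MvPolynomial (Fin n) R :=
  ∑ B ∈ Finset.univ.filter (fun B : Finset (Fin n) => M.IsBase (B : Set (Fin n))),
    ∏ i ∈ B, MvPolynomial.X i

open Classical in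
/-- The independent set generating polynomial `∑_I (∏_{i ∈ I} x_i) x_0 ^ (n - |I|)`, summed over
the independent sets `I` of `M`. The variable with index `0 : Fin (n + 1)` is `x_0`; the variable
attached to the element `i : Fin n` of the matroid has index `i.succ`. -/
def Matroid.indepPoly (R : Type*) [CommRing R] {n : ℕ} (M : Matroid (Fin n)) :
    MvPolynomial (Fin (n + 1)) R :=
  ∑ I ∈ Finset.univ.filter (fun I : Finset (Fin n) => M.Indep (I : Set (Fin n))),
    (∏ i ∈ I, MvPolynomial.X i.succ) * MvPolynomial.X 0 ^ (n - I.card)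

/-- The reduced independent set generating polynomial `(∂/∂x_0)^(n - r)` of the independent set
generating polynomial, `r` being the rank of `M`. -/
def Matroid.reducedIndepPoly (R : Type*) [CommRing R] {n : ℕ} (M : Matroid (Fin n)) :
    MvPolynomial (Fin (n + 1)) R :=
  (fun p => MvPolynomial.pderiv 0 p)^[n - M.eRank.toNat] (M.indepPoly R)

/-- The Hessian matrix `(∂_i ∂_j f)` of a polynomial, evaluated at the point `a`. -/
def MvPolynomial.hessianAt {ι R : Type*} [CommRing R] (f : MvPolynomial ι R) (a : ι → R) :
    Matrix ι ι R :=
  Matrix.of fun i j => MvPolynomial.eval a (MvPolynomial.pderiv i (MvPolynomial.pderiv j f))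

/-- The real (symmetric) matrix `A` has signature `(+,-,…,-)`: its quadratic form `x ↦ xᵀ A x` has
positive index of inertia `1` and negative index of inertia `|ι| - 1`. -/
def Matrix.HasLorentzianSignature {ι : Type*} [Fintype ι] [DecidableEq ι]
    (A : Matrix ι ι ℝ) : Prop :=
  sigPos A.toQuadraticForm' = 1 ∧
    sigNeg A.toQuadraticForm' + 1 = Fintype.card ι

/-- A real polynomial is strictly log-concave on `X` if it is positive on `X` and its logarithm is
a strictly concave function on `X` (in particular `X` is convex). -/
def MvPolynomial.StrictlyLogConcaveOn {ι : Type*} (f : MvPolynomial ι ℝ)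
    (X : Set (ι → ℝ)) : Prop :=
  (∀ x ∈ X, 0 < MvPolynomial.eval x f) ∧
    StrictConcaveOn ℝ X fun x => Real.log (MvPolynomial.eval x f)

end

/-! ### Reverse Cauchy–Schwarz for symmetric matrices, signature and a Perron-type spectral bound -/

noncomputable section

open Matrix

namespace Matrix

variable {ι : Type*} [Fintype ι] {H : Matrix ι ι ℝ} {a : ι → ℝ}

/-! Signature is encoded by the reverse Cauchy–Schwarz inequality `ReverseCS H a` together with `0 <
aᵀHa` and a trivial kernel. Both are studied for all derivatives `∂_S ∂_0^k P_M` (`indepPolyDeriv`),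
a family closed under differentiation up to zero.

The inequality goes by induction on the degree. A quadratic derivative has form `k!` times a square
minus a positive semidefinite form (`dotProduct_hessianAt_mulVec_eq`), because the contraction `M /
S` has at most `n - |S|` parallel classes. In higher degree, the inequalities of the first partials
add up, by Euler's formula, to a bound forcing each positive eigenvalue of a normalized Hessian to
be at least `1`; Perron's bound then leaves only the direction of `a`
(`quadratic_nonpos_of_le_sum`). This needs `a_0 > 0`; the case `a_0 = 0` is a limit.

For nondegeneracy, a kernel vector `v` of the Hessian stays in the kernel after differentiating in
any variable that is positive at `a`, hence lies in the kernel of the quadric of every independent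
`S` of size `r - 2`. There all class sums of `v` equal `-v_0`, and `v_0 ≠ 0` would make the elements
outside `S` nonloops of `M / S` in distinct parallel classes, for every such `S`, so `M` would be
uniform. Once `v_0 = 0`, counting along the lines of contractions (`setSum_closure_insert_eq`)
carries the vanishing down to single elements, where simplicity gives `v = 0`.

Finally `(n - r)! f_M` is the reduced polynomial at `x_0 = 0`, so directions with `v_0 = 0` suffice
and uniform matroids need no exclusion. Strict log-concavity follows by differentiating twice along
segments. -/

lemma IsSymm.dotProduct_mulVec_comm (hH : H.IsSymm) (x y : ι → ℝ) :
    x ⬝ᵥ H *ᵥ y = y ⬝ᵥ H *ᵥ x := by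
  rw [dotProduct_mulVec, ← mulVec_transpose, hH.eq, dotProduct_comm]

/-- The reverse Cauchy–Schwarz inequality of the bilinear form of `H` at the vector `a`. -/
def ReverseCS (H : Matrix ι ι ℝ) (a : ι → ℝ) : Prop :=
  ∀ v, (a ⬝ᵥ H *ᵥ a) * (v ⬝ᵥ H *ᵥ v) ≤ (a ⬝ᵥ H *ᵥ v) ^ 2

lemma reverseCS_zero (a : ι → ℝ) : ReverseCS (0 : Matrix ι ι ℝ) a := by
  intro v; simp

lemma quadratic_add_smul (hH : H.IsSymm) (x y : ι → ℝ) (c : ℝ) :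
    (x + c • y) ⬝ᵥ H *ᵥ (x + c • y) =
      x ⬝ᵥ H *ᵥ x + 2 * c * (x ⬝ᵥ H *ᵥ y) + c ^ 2 * (y ⬝ᵥ H *ᵥ y) := by
  rw [mulVec_add, mulVec_smul, add_dotProduct, dotProduct_add, dotProduct_add, smul_dotProduct,
    smul_dotProduct, dotProduct_smul, dotProduct_smul, hH.dotProduct_mulVec_comm y x]
  simp only [smul_eq_mul]
  ring

/-- Subtracting from `v` its `H`-projection onto `a` gives a vector orthogonal to `a`; expanding its
quadratic form yields the inequality. -/
lemma reverseCS_of_forall_orthogonal (hH : H.IsSymm) (ha : 0 < a ⬝ᵥ H *ᵥ a)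
    (h : ∀ v, a ⬝ᵥ H *ᵥ v = 0 → v ⬝ᵥ H *ᵥ v ≤ 0) : ReverseCS H a := by
  intro v
  have h1 := h (v + (-(a ⬝ᵥ H *ᵥ v) / (a ⬝ᵥ H *ᵥ a)) • a) (by
    rw [mulVec_add, mulVec_smul, dotProduct_add, dotProduct_smul, smul_eq_mul]
    field_simp
    ring)
  rw [quadratic_add_smul hH, hH.dotProduct_mulVec_comm v a] at h1
  set p := a ⬝ᵥ H *ᵥ a
  set q := a ⬝ᵥ H *ᵥ v
  have : v ⬝ᵥ H *ᵥ v + 2 * (-q / p) * q + (-q / p) ^ 2 * p = v ⬝ᵥ H *ᵥ v - q ^ 2 / p := by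
    field_simp
    ring
  rw [this, sub_nonpos, le_div_iff₀ ha] at h1
  linarith

lemma ReverseCS.nonpos (h : ReverseCS H a) (ha : 0 < a ⬝ᵥ H *ᵥ a) {v : ι → ℝ}
    (hv : a ⬝ᵥ H *ᵥ v = 0) : v ⬝ᵥ H *ᵥ v ≤ 0 := by
  have := h v
  rw [hv] at this
  nlinarith

/-- Equality case. The form is nonpositive on the hyperplane `H`-orthogonal to `a`, so a null vector
there is orthogonal to the whole hyperplane, and it is orthogonal to `a` as well. -/
lemma ReverseCS.mulVec_eq_zero (h : ReverseCS H a) (hH : H.IsSymm) (ha : 0 < a ⬝ᵥ H *ᵥ a)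
    {v : ι → ℝ} (hv : a ⬝ᵥ H *ᵥ v = 0) (hvv : v ⬝ᵥ H *ᵥ v = 0) : H *ᵥ v = 0 := by
  classical
  have key : ∀ w, a ⬝ᵥ H *ᵥ w = 0 → w ⬝ᵥ H *ᵥ v = 0 := by
    intro w hw
    have h2 : ∀ c : ℝ, 2 * c * (w ⬝ᵥ H *ᵥ v) + w ⬝ᵥ H *ᵥ w ≤ 0 := by
      intro c
      have := h.nonpos ha (v := w + c • v) (by
        rw [mulVec_add, mulVec_smul, dotProduct_add, dotProduct_smul, hw, hv]; simp)
      rw [quadratic_add_smul hH, hvv] at this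
      linarith
    by_contra hne
    -- This value of `c` makes the left side of `h2` equal to `1`.
    have := h2 ((1 - w ⬝ᵥ H *ᵥ w) / (2 * (w ⬝ᵥ H *ᵥ v)))
    field_simp at this
    linarith
  have key' : ∀ w, w ⬝ᵥ H *ᵥ v = 0 := by
    intro w
    have := key (w + (-(a ⬝ᵥ H *ᵥ w) / (a ⬝ᵥ H *ᵥ a)) • a) (by
      rw [mulVec_add, mulVec_smul, dotProduct_add, dotProduct_smul, smul_eq_mul]
      field_simp
      ring)
    rwa [add_dotProduct, smul_dotProduct, hv, smul_zero, add_zero] at this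
  ext i
  simpa using key' (Pi.single i 1)

lemma toQuadraticForm'_apply_eq [DecidableEq ι] (H : Matrix ι ι ℝ) (v : ι → ℝ) :
    H.toQuadraticForm' v = v ⬝ᵥ H *ᵥ v := by
  simp [toQuadraticForm', toLinearMap₂'_apply']

/-- The form is positive on the line of `a` and negative definite on the complementary hyperplane
`ker φ`, since a null vector there would lie in the kernel of `H`. -/
theorem ReverseCS.hasLorentzianSignature [DecidableEq ι] (h : ReverseCS H a) (hH : H.IsSymm)
    (ha : 0 < a ⬝ᵥ H *ᵥ a) (hker : ∀ v, H *ᵥ v = 0 → v = 0) : H.HasLorentzianSignature := by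
  set φ : (ι → ℝ) →ₗ[ℝ] ℝ := (dotProductBilin ℝ ℝ a) ∘ₗ H.mulVecLin with hφ
  have φ_apply : ∀ v, φ v = a ⬝ᵥ H *ᵥ v := fun v => rfl
  have hneg : ∀ v ∈ LinearMap.ker φ, H.toQuadraticForm' v ≤ 0 := by
    intro v hv
    rw [toQuadraticForm'_apply_eq]
    exact h.nonpos ha hv
  have hdim : Module.finrank ℝ (LinearMap.ker φ) + 1 = Fintype.card ι := by
    have h1 := LinearMap.finrank_range_add_finrank_ker φ
    have h2 : LinearMap.range φ = ⊤ := by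
      apply LinearMap.range_eq_top.2
      apply LinearMap.surjective
      intro h0
      have := φ_apply a
      rw [h0] at this
      simp at this
      linarith
    rw [h2, finrank_top, Module.finrank_self, Module.finrank_fintype_fun_eq_card] at h1
    omega
  have h1 := QuadraticForm.sigPos_add_finrank_le_of_nonpos hneg
  rw [Module.finrank_fintype_fun_eq_card] at h1
  have h2 : 1 ≤ sigPos H.toQuadraticForm' := by
    have ha0 : a ≠ 0 := by rintro rfl; simp at ha
    rw [← finrank_span_singleton (K := ℝ) ha0]
    apply le_sigPos_of_posDef
    rintro ⟨x, hx⟩ hx0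
    obtain ⟨c, rfl⟩ := Submodule.mem_span_singleton.1 hx
    have hc : c ≠ 0 := by
      rintro rfl
      simp at hx0
    rw [QuadraticMap.restrict_apply, QuadraticMap.map_smul, toQuadraticForm'_apply_eq, smul_eq_mul]
    have := mul_self_pos.2 hc
    positivity
  have h3 : Module.finrank ℝ (LinearMap.ker φ) ≤ sigNeg H.toQuadraticForm' := by
    apply le_sigNeg_of_negDef
    rintro ⟨x, hx⟩ hx0
    rw [QuadraticMap.restrict_apply, _root_.neg_apply, neg_pos]
    refine lt_of_le_of_ne (hneg x hx) fun h0 => hx0 ?_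
    rw [toQuadraticForm'_apply_eq] at h0
    exact Subtype.ext (hker x (h.mulVec_eq_zero hH ha hx h0))
  have h4 := QuadraticForm.sigPos_add_sigNeg_add_radical (Q := H.toQuadraticForm')
  rw [Module.finrank_fintype_fun_eq_card] at h4
  constructor <;> omega

/-- The equality case of Perron's bound for a matrix with a positive row. -/
lemma mulVec_eq_smul_of_eigenvector (hH : H.IsSymm) (hnn : ∀ i j, 0 ≤ H i j) {o : ι}
    (ho : ∀ i, 0 < H o i ∨ ∀ j, H i j = 0) (ha : ∀ i, 0 < a i) {w : ι → ℝ} {c : ℝ} (hc : 1 ≤ c)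
    (hw : ∀ i, c * ((H *ᵥ a) i * w i) = (H *ᵥ fun j => a j * w j) i) :
    (H *ᵥ fun j => a j * w j) = w o • H *ᵥ a := by
  have hsym : ∀ i j, H i j = H j i := fun i j => (hH.apply i j).symm
  set X := ∑ i, (H *ᵥ a) i * a i * w i ^ 2 with hX
  have hX0 : 0 ≤ X := by
    refine Finset.sum_nonneg fun i _ => ?_
    have : 0 ≤ (H *ᵥ a) i := Finset.sum_nonneg fun j _ => mul_nonneg (hnn i j) (ha j).le
    have := ha i
    positivity
  have h1 : c * X = ∑ i, ∑ j, H i j * a i * a j * (w i * w j) := by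
    rw [hX, Finset.mul_sum]
    refine Finset.sum_congr rfl fun i _ => ?_
    calc c * ((H *ᵥ a) i * a i * w i ^ 2) = c * ((H *ᵥ a) i * w i) * (a i * w i) := by ring
      _ = _ := by
        rw [hw i, mulVec, dotProduct, Finset.sum_mul]
        refine Finset.sum_congr rfl fun j _ => by ring
  have hXl : X = ∑ i, ∑ j, H i j * a i * a j * w i ^ 2 := by
    rw [hX]
    refine Finset.sum_congr rfl fun i _ => ?_
    rw [mulVec, dotProduct, Finset.sum_mul, Finset.sum_mul]
    refine Finset.sum_congr rfl fun j _ => by ring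
  have hXr : X = ∑ i, ∑ j, H i j * a i * a j * w j ^ 2 := by
    rw [hXl, Finset.sum_comm]
    refine Finset.sum_congr rfl fun i _ => Finset.sum_congr rfl fun j _ => ?_
    rw [hsym j i]; ring
  -- The weighted Laplacian form is nonnegative termwise, yet equals `2 (1 - c) X ≤ 0`; so every
  -- term vanishes and `w` is constant on the neighbours of `o`.
  have h2 : ∑ i, ∑ j, H i j * a i * a j * (w i - w j) ^ 2 = 2 * (X - c * X) := by
    have : 2 * (X - c * X) = X + X - 2 * (c * X) := by ring
    rw [this, h1]
    nth_rewrite 1 [hXl]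
    nth_rewrite 1 [hXr]
    rw [Finset.mul_sum, ← Finset.sum_add_distrib, ← Finset.sum_sub_distrib]
    refine Finset.sum_congr rfl fun i _ => ?_
    rw [Finset.mul_sum, ← Finset.sum_add_distrib, ← Finset.sum_sub_distrib]
    refine Finset.sum_congr rfl fun j _ => by ring
  have hterm : ∀ i j, 0 ≤ H i j * a i * a j * (w i - w j) ^ 2 := fun i j => by
    have := hnn i j; have := ha i; have := ha j; positivity
  have h3 : ∑ i, ∑ j, H i j * a i * a j * (w i - w j) ^ 2 = 0 := by
    refine le_antisymm ?_ (Finset.sum_nonneg fun i _ => Finset.sum_nonneg fun j _ => hterm i j)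
    rw [h2]; nlinarith
  have h4 : ∀ i, 0 < H o i → w i = w o := by
    intro i hi
    have h5 := (Finset.sum_eq_zero_iff_of_nonneg
      fun i _ => Finset.sum_nonneg fun j _ => hterm i j).1 h3 o (Finset.mem_univ _)
    have h6 := (Finset.sum_eq_zero_iff_of_nonneg fun j _ => hterm o j).1 h5 i (Finset.mem_univ _)
    have h7 : (w o - w i) ^ 2 = 0 :=
      (mul_eq_zero.1 h6).resolve_left (mul_pos (mul_pos hi (ha o)) (ha i)).ne'
    have := pow_eq_zero_iff (two_ne_zero) |>.1 h7
    linarith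
  ext i
  rw [Pi.smul_apply, smul_eq_mul, mulVec, mulVec, dotProduct, dotProduct, Finset.mul_sum]
  refine Finset.sum_congr rfl fun j _ => ?_
  rcases ho j with hj | hj
  · rw [h4 j hj]; ring
  · rw [hsym i j, hj i]; ring

/-- With `D = diag(a_i / (Ha)_i)` and `K = D^{1/2} H D^{1/2}`, the bound `hle` gives `λ ≤ λ²` for
each eigenvalue `λ` of `K`. A positive `λ` is then at least `1`, and the equality case of Perron's
bound makes its eigenvectors invisible to a `y` orthogonal to `a`. -/
theorem quadratic_nonpos_of_le_sum (hH : H.IsSymm) (hnn : ∀ i j, 0 ≤ H i j) {o : ι}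
    (ho : ∀ i, 0 < H o i ∨ ∀ j, H i j = 0) (ha : ∀ i, 0 < a i)
    (hle : ∀ v, v ⬝ᵥ H *ᵥ v ≤ ∑ i, a i / (H *ᵥ a) i * (H *ᵥ v) i ^ 2)
    {y : ι → ℝ} (hy : a ⬝ᵥ H *ᵥ y = 0) : y ⬝ᵥ H *ᵥ y ≤ 0 := by
  classical
  have hsym : ∀ i j, H i j = H j i := fun i j => (hH.apply i j).symm
  have hrow : ∀ i, 0 < (H *ᵥ a) i ∨ ∀ j, H i j = 0 := by
    intro i
    rcases ho i with hi | hi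
    · left
      refine Finset.sum_pos' (fun j _ => mul_nonneg (hnn i j) (ha j).le) ⟨o, Finset.mem_univ _, ?_⟩
      exact mul_pos (hi.trans_eq (hsym o i)) (ha o)
    · exact Or.inr hi
  -- If `(Ha)_i = 0`, division by zero gives `s i = 0`; this is harmless, as row `i` of `H` is then
  -- zero.
  set s : ι → ℝ := fun i => √(a i / (H *ᵥ a) i) with hs
  have hHa : ∀ i, 0 ≤ (H *ᵥ a) i := fun i =>
    Finset.sum_nonneg fun j _ => mul_nonneg (hnn i j) (ha j).le
  have hs2 : ∀ i, s i ^ 2 = a i / (H *ᵥ a) i := fun i =>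
    Real.sq_sqrt (div_nonneg (ha i).le (hHa i))
  set K : Matrix ι ι ℝ := Matrix.of fun i j => s i * H i j * s j with hK
  have hKsymm : K.IsHermitian := by
    ext i j
    simp only [hK, conjTranspose_apply, of_apply, star_trivial]
    rw [hsym i j]; ring
  have hKv : ∀ u : ι → ℝ, ∀ i, (K *ᵥ u) i = s i * (H *ᵥ fun j => s j * u j) i := by
    intro u i
    simp only [mulVec, dotProduct, hK, of_apply, Finset.mul_sum]
    refine Finset.sum_congr rfl fun j _ => by ring
  have hKq : ∀ x u : ι → ℝ, x ⬝ᵥ K *ᵥ u =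
      (fun i => s i * x i) ⬝ᵥ H *ᵥ fun i => s i * u i := by
    intro x u
    simp only [dotProduct, hKv]
    refine Finset.sum_congr rfl fun j _ => by ring
  set b := hKsymm.eigenvectorBasis
  set ev := hKsymm.eigenvalues
  have hb : ∀ j, K *ᵥ ⇑(b j) = ev j • ⇑(b j) := hKsymm.mulVec_eigenvectorBasis
  have hbb : ∀ j, (⇑(b j) : ι → ℝ) ⬝ᵥ ⇑(b j) = 1 := by
    intro j
    have h1 := b.norm_eq_one j
    have h2 := EuclideanSpace.real_norm_sq_eq (b j)
    rw [h1] at h2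
    rw [dotProduct, show (1 : ℝ) = 1 ^ 2 by norm_num, h2]
    exact Finset.sum_congr rfl fun i _ => by ring
  set u : ι → ℝ := fun i => y i / s i with hu
  have hspos : ∀ i, 0 < (H *ᵥ a) i → 0 < s i := fun i hi => Real.sqrt_pos.2 (div_pos (ha i) hi)
  have hHu : (H *ᵥ fun i => s i * u i) = H *ᵥ y := by
    ext i
    refine Finset.sum_congr rfl fun j _ => ?_
    change H i j * (s j * u j) = H i j * y j
    rcases hrow j with hj | hj
    · have := hspos j hj
      simp only [hu]
      congr 1
      field_simp
    · rw [hsym i j, hj i]; simp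
  have hdu : ∀ x : ι → ℝ, (fun i => s i * u i) ⬝ᵥ H *ᵥ x = y ⬝ᵥ H *ᵥ x := by
    intro x
    rw [hH.dotProduct_mulVec_comm, hHu, hH.dotProduct_mulVec_comm]
  have hexp : y ⬝ᵥ H *ᵥ y = ∑ j, ev j * ((⇑(b j) : ι → ℝ) ⬝ᵥ u) ^ 2 := by
    rw [← hdu, ← hHu, ← hKq]
    have h1 := b.sum_inner_mul_inner (WithLp.toLp 2 u) (WithLp.toLp 2 (K *ᵥ u))
    have h2 : ∀ x z : EuclideanSpace ℝ ι, inner ℝ x z = (⇑x : ι → ℝ) ⬝ᵥ ⇑z := by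
      intro x z
      simp [PiLp.inner_apply, dotProduct, mul_comm]
    simp only [h2] at h1
    rw [← h1]
    refine Finset.sum_congr rfl fun j _ => ?_
    have h3 : (⇑(b j) : ι → ℝ) ⬝ᵥ K *ᵥ u = ev j * ((⇑(b j) : ι → ℝ) ⬝ᵥ u) := by
      rw [IsSymm.dotProduct_mulVec_comm (by simpa [IsHermitian, IsSymm] using hKsymm), hb,
        dotProduct_smul, smul_eq_mul, dotProduct_comm]
    change (u ⬝ᵥ ⇑(b j)) * ((⇑(b j) : ι → ℝ) ⬝ᵥ K *ᵥ u) = _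
    rw [h3, dotProduct_comm u]
    ring
  rw [hexp]
  refine Finset.sum_nonpos fun j _ => ?_
  by_cases hev : ev j ≤ 0
  · exact mul_nonpos_of_nonpos_of_nonneg hev (sq_nonneg _)
  push Not at hev
  set e : ι → ℝ := ⇑(b j) with he
  have hev1 : 1 ≤ ev j := by
    have h1 : e ⬝ᵥ K *ᵥ e = ev j := by rw [hb, dotProduct_smul, hbb]; simp
    have h2 := hle fun i => s i * e i
    rw [← hKq, h1] at h2
    have h3 : ∑ i, a i / (H *ᵥ a) i * (H *ᵥ fun i => s i * e i) i ^ 2 = ev j ^ 2 := by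
      calc _ = ∑ i, (K *ᵥ e) i * (K *ᵥ e) i :=
            Finset.sum_congr rfl fun i _ => by rw [hKv, ← hs2]; ring
        _ = (K *ᵥ e) ⬝ᵥ (K *ᵥ e) := rfl
        _ = _ := by
          rw [hb, smul_dotProduct, dotProduct_smul, hbb]; simp; ring
    rw [h3] at h2
    nlinarith
  have hse : (fun i => a i * (s i * e i / a i)) = fun i => s i * e i := by
    ext i
    have := ha i
    field_simp
  -- The weights are chosen so that `a * w = s * e`; the eigenvector equation of `K` then takes the
  -- required form.
  have hper := mulVec_eq_smul_of_eigenvector hH hnn ho ha (w := fun i => s i * e i / a i) hev1 (by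
    intro i
    rw [hse]
    rcases hrow i with hi | hi
    · have h1 : (K *ᵥ e) i = ev j * e i := by rw [hb]; rfl
      rw [hKv] at h1
      have h2 : ev j * ((H *ᵥ a) i * (s i * e i / a i)) =
          (H *ᵥ a) i * s i / a i * (ev j * e i) := by ring
      rw [h2, ← h1]
      have h3 : (H *ᵥ a) i * s i / a i * (s i * (H *ᵥ fun j => s j * e j) i) =
        (H *ᵥ a) i / a i * s i ^ 2 * (H *ᵥ fun j => s j * e j) i := by ring
      rw [h3, hs2]
      have := ha i
      field_simp
    · have h1 : ∀ x : ι → ℝ, (H *ᵥ x) i = 0 := fun x => by simp [mulVec, dotProduct, hi]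
      rw [h1, h1]; simp)
  rw [hse] at hper
  have h0 : ev j * (e ⬝ᵥ u) = 0 := by
    have h1 : ev j * (e ⬝ᵥ u) = u ⬝ᵥ K *ᵥ e := by
      rw [hb, dotProduct_smul, smul_eq_mul, dotProduct_comm]
    rw [h1, hKq, hper, dotProduct_smul, hdu, hH.dotProduct_mulVec_comm, hy, smul_zero]
  rw [(mul_eq_zero.1 h0).resolve_left hev.ne']
  simp

end Matrix
end

/-! ### Hessians of homogeneous polynomials and Euler's formula -/

noncomputable section

open Matrix

namespace MvPolynomial

variable {ι : Type*} {p : MvPolynomial ι ℝ} {a : ι → ℝ} {m : ℕ}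

lemma pderiv_comm {R : Type*} [CommRing R] (i j : ι) (p : MvPolynomial ι R) :
    pderiv i (pderiv j p) = pderiv j (pderiv i p) := by
  classical
  -- The commutator of two derivations is a derivation, so it is enough that it kills the variables.
  have h : ⁅pderiv (R := R) i, pderiv (R := R) j⁆ = 0 := by
    apply derivation_ext
    intro k
    simp only [Derivation.commutator_apply, pderiv_X, Derivation.coe_zero, Pi.zero_apply]
    by_cases h1 : i = k <;> by_cases h2 : j = k <;> simp [h1, h2]
  have := DFunLike.congr_fun h p
  rwa [Derivation.commutator_apply, Derivation.coe_zero, Pi.zero_apply, sub_eq_zero] at this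

lemma hessianAt_apply {R : Type*} [CommRing R] (p : MvPolynomial ι R) (a : ι → R) (i j : ι) :
    p.hessianAt a i j = eval a (pderiv i (pderiv j p)) := rfl

lemma isSymm_hessianAt {R : Type*} [CommRing R] (p : MvPolynomial ι R) (a : ι → R) :
    (p.hessianAt a).IsSymm := by
  ext i j
  rw [transpose_apply, hessianAt_apply, hessianAt_apply, pderiv_comm]

lemma hessianAt_zero (a : ι → ℝ) : (0 : MvPolynomial ι ℝ).hessianAt a = 0 := by
  ext i j
  simp [hessianAt_apply]

variable [Fintype ι]

lemma IsHomogeneous.sum_mul_eval_pderiv (hp : p.IsHomogeneous m) (a : ι → ℝ) :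
    ∑ i, a i * eval a (pderiv i p) = m * eval a p := by
  have := congrArg (eval a) hp.sum_X_mul_pderiv
  simpa using this

lemma IsHomogeneous.hessianAt_mulVec (hp : p.IsHomogeneous (m + 2)) (a : ι → ℝ) (i : ι) :
    (p.hessianAt a *ᵥ a) i = (m + 1) * eval a (pderiv i p) := by
  have h := (hp.pderiv (i := i)).sum_mul_eval_pderiv a
  rw [show m + 2 - 1 = m + 1 by omega] at h
  push_cast at h
  rw [← h, mulVec, dotProduct]
  refine Finset.sum_congr rfl fun j _ => ?_
  rw [hessianAt_apply, pderiv_comm, mul_comm]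

lemma IsHomogeneous.dotProduct_hessianAt_mulVec (hp : p.IsHomogeneous (m + 2)) (a : ι → ℝ) :
    a ⬝ᵥ p.hessianAt a *ᵥ a = (m + 1) * (m + 2) * eval a p := by
  have h := hp.sum_mul_eval_pderiv a
  push_cast at h
  rw [mul_assoc, ← h, dotProduct, Finset.mul_sum]
  refine Finset.sum_congr rfl fun j _ => ?_
  rw [hp.hessianAt_mulVec]; ring

lemma IsHomogeneous.dotProduct_hessianAt_pderiv_mulVec (hp : p.IsHomogeneous (m + 3))
    (a v : ι → ℝ) (k : ι) :
    a ⬝ᵥ (pderiv k p).hessianAt a *ᵥ v = (m + 1) * (p.hessianAt a *ᵥ v) k := by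
  rw [(isSymm_hessianAt _ _).dotProduct_mulVec_comm, dotProduct, mulVec, dotProduct,
    Finset.mul_sum]
  have hp' : (pderiv k p).IsHomogeneous (m + 2) := hp.pderiv
  refine Finset.sum_congr rfl fun j _ => ?_
  rw [hp'.hessianAt_mulVec, hessianAt_apply, pderiv_comm]
  ring

lemma IsHomogeneous.sum_mul_hessianAt_pderiv (hp : p.IsHomogeneous (m + 3)) (a v : ι → ℝ) :
    ∑ k, a k * (v ⬝ᵥ (pderiv k p).hessianAt a *ᵥ v) = (m + 1) * (v ⬝ᵥ p.hessianAt a *ᵥ v) := by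
  simp only [dotProduct, mulVec, Finset.mul_sum]
  rw [Finset.sum_comm]
  refine Finset.sum_congr rfl fun i _ => ?_
  rw [Finset.sum_comm]
  refine Finset.sum_congr rfl fun j _ => ?_
  have hp' : (pderiv i (pderiv j p)).IsHomogeneous (m + 1) := (hp.pderiv (i := j)).pderiv (i := i)
  have h := hp'.sum_mul_eval_pderiv a
  push_cast at h
  calc _ = v i * v j * ∑ k, a k * eval a (pderiv k (pderiv i (pderiv j p))) := by
        rw [Finset.mul_sum]
        refine Finset.sum_congr rfl fun k _ => ?_
        rw [hessianAt_apply, pderiv_comm j k, pderiv_comm i k]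
        ring
    _ = _ := by rw [h, hessianAt_apply]; ring

/-- The local-to-global step for the reverse Cauchy–Schwarz inequality of Hessians. -/
theorem IsHomogeneous.reverseCS_hessianAt (hp : p.IsHomogeneous (m + 3)) (ha : ∀ i, 0 < a i)
    (hpos : 0 < eval a p) (hnn : ∀ i j, 0 ≤ p.hessianAt a i j) {o : ι}
    (ho : ∀ k, 0 < p.hessianAt a o k ∨ pderiv k p = 0)
    (h : ∀ k, ((pderiv k p).hessianAt a).ReverseCS a) : (p.hessianAt a).ReverseCS a := by
  have hm : (0 : ℝ) < m + 1 := by positivity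
  refine reverseCS_of_forall_orthogonal (isSymm_hessianAt _ _) ?_ fun y hy => ?_
  · rw [IsHomogeneous.dotProduct_hessianAt_mulVec (m := m + 1) hp]
    positivity
  have hrow : ∀ k, pderiv k p = 0 → ∀ j, p.hessianAt a k j = 0 := fun k hk j => by
    rw [hessianAt_apply, pderiv_comm, hk]; simp
  refine quadratic_nonpos_of_le_sum (isSymm_hessianAt _ _) hnn
    (fun i => (ho i).imp_right (hrow i)) ha (fun v => ?_) hy
  -- By Euler, `vᵀHv` is a weighted sum of the forms of the partials; each summand is bounded by its
  -- own reverse Cauchy–Schwarz inequality, which supplies the hypothesis of the spectral bound.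
  have h1 := hp.sum_mul_hessianAt_pderiv a v
  refine le_of_mul_le_mul_left ?_ hm
  rw [← h1, Finset.mul_sum]
  refine Finset.sum_le_sum fun k _ => ?_
  rcases ho k with hk | hk
  · have hHa : 0 < (p.hessianAt a *ᵥ a) k := by
      refine Finset.sum_pos' (fun j _ => mul_nonneg (hnn k j) (ha j).le) ⟨o, Finset.mem_univ _, ?_⟩
      exact mul_pos (hk.trans_eq ((isSymm_hessianAt p a).apply k o)) (ha o)
    have h2 := h k v
    rw [hp.dotProduct_hessianAt_pderiv_mulVec, hp.dotProduct_hessianAt_pderiv_mulVec] at h2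
    set X := (p.hessianAt a *ᵥ a) k
    set Y := (p.hessianAt a *ᵥ v) k
    set Z := v ⬝ᵥ (pderiv k p).hessianAt a *ᵥ v
    have h3 : Z ≤ (m + 1) * Y ^ 2 / X := by
      rw [le_div_iff₀ hHa]
      refine le_of_mul_le_mul_left ?_ hm
      nlinarith
    calc a k * Z ≤ a k * ((m + 1) * Y ^ 2 / X) := mul_le_mul_of_nonneg_left h3 (ha k).le
      _ = _ := by ring
  · have h2 : (p.hessianAt a *ᵥ v) k = 0 := by
      simp [mulVec, dotProduct, hrow k hk]
    rw [hk, hessianAt_zero, h2]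
    simp

/-- `Hv = 0` makes `v` orthogonal to `a` for every partial, so all their forms are nonpositive at
`v`. Their `a`-weighted sum is `0` by Euler, so those with `a k > 0` vanish and the equality case
applies. -/
theorem IsHomogeneous.hessianAt_pderiv_mulVec_eq_zero (hp : p.IsHomogeneous (m + 3))
    (ha : ∀ i, 0 ≤ a i) (hpos : ∀ k, 0 < eval a (pderiv k p) ∨ pderiv k p = 0)
    (h : ∀ k, ((pderiv k p).hessianAt a).ReverseCS a) {v : ι → ℝ} (hv : p.hessianAt a *ᵥ v = 0)
    {k : ι} (hk : 0 < a k) : (pderiv k p).hessianAt a *ᵥ v = 0 := by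
  have horth : ∀ k, a ⬝ᵥ (pderiv k p).hessianAt a *ᵥ v = 0 := fun k => by
    rw [hp.dotProduct_hessianAt_pderiv_mulVec, hv]; simp
  have hposq : ∀ k, 0 < eval a (pderiv k p) → 0 < a ⬝ᵥ (pderiv k p).hessianAt a *ᵥ a :=
    fun k hk => by
      have hp' : (pderiv k p).IsHomogeneous (m + 2) := hp.pderiv
      rw [hp'.dotProduct_hessianAt_mulVec]
      positivity
  have hnonpos : ∀ k, v ⬝ᵥ (pderiv k p).hessianAt a *ᵥ v ≤ 0 := fun k => by
    rcases hpos k with hk | hk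
    · exact (h k).nonpos (hposq k hk) (horth k)
    · rw [hk, hessianAt_zero]; simp
  have hsum := hp.sum_mul_hessianAt_pderiv a v
  rw [hv, dotProduct_zero, mul_zero] at hsum
  have hzero := (Finset.sum_eq_zero_iff_of_nonpos fun k _ =>
    mul_nonpos_of_nonneg_of_nonpos (ha k) (hnonpos k)).1 hsum k (Finset.mem_univ _)
  rcases hpos k with hk' | hk'
  · exact (h k).mulVec_eq_zero (isSymm_hessianAt _ _) (hposq k hk') (horth k)
      ((mul_eq_zero.1 hzero).resolve_left hk.ne')
  · rw [hk', hessianAt_zero]; simp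

end MvPolynomial
end

/-! ### Mixed derivatives of the independent set generating polynomial -/

noncomputable section

open Matrix MvPolynomial

lemma MvPolynomial.pderiv_prod_X_of_notMem {ι κ R : Type*} [CommRing R] {f : κ → ι}
    {i : ι} {T : Finset κ} (hi : ∀ j ∈ T, f j ≠ i) :
    pderiv i (∏ j ∈ T, (X (f j) : MvPolynomial ι R)) = 0 := by
  classical
  induction T using Finset.induction_on with
  | empty => simp
  | insert j T hj ih =>
    rw [Finset.prod_insert hj, pderiv_mul, ih fun k hk => hi k (Finset.mem_insert_of_mem hk),
      pderiv_X_of_ne (hi j (Finset.mem_insert_self _ _))]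
    simp

lemma MvPolynomial.pderiv_prod_X {ι κ R : Type*} [CommRing R] [DecidableEq κ] {f : κ → ι}
    (hf : f.Injective) {i : κ} {T : Finset κ} (hi : i ∈ T) :
    pderiv (f i) (∏ j ∈ T, (X (f j) : MvPolynomial ι R)) = ∏ j ∈ T.erase i, X (f j) := by
  rw [← Finset.mul_prod_erase T _ hi, pderiv_mul, pderiv_X_self,
    pderiv_prod_X_of_notMem (T := T.erase i)]
  · simp
  · intro j hj
    exact fun h => (Finset.mem_erase.1 hj).1 (hf h)

namespace Matroid

variable {n : ℕ}

open Classical in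
/-- The mixed partial derivative `∂_S (∂/∂x_0)^k` of the independent set generating polynomial. -/
def indepPolyDeriv (M : Matroid (Fin n)) (S : Finset (Fin n)) (k : ℕ) :
    MvPolynomial (Fin (n + 1)) ℝ :=
  ∑ I ∈ Finset.univ.filter (fun I : Finset (Fin n) => M.Indep (I : Set (Fin n)) ∧ S ⊆ I),
    C (((n - I.card).descFactorial k : ℕ) : ℝ) *
      ((∏ i ∈ I \ S, X i.succ) * X 0 ^ (n - I.card - k))

variable {M : Matroid (Fin n)} {S : Finset (Fin n)} {k : ℕ} {a : Fin (n + 1) → ℝ}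

lemma indepPolyDeriv_eq_zero (hS : ¬ M.Indep (S : Set (Fin n))) : M.indepPolyDeriv S k = 0 := by
  classical
  refine Finset.sum_eq_zero fun I hI => ?_
  obtain ⟨hI, hSI⟩ := (Finset.mem_filter.1 hI).2
  exact absurd (hI.subset (Finset.coe_subset.2 hSI)) hS

lemma indepPolyDeriv_empty_zero : M.indepPolyDeriv ∅ 0 = M.indepPoly ℝ := by
  classical
  refine Finset.sum_congr (Finset.filter_congr fun I _ => by simp) fun I _ => by simp

lemma pderiv_zero_indepPolyDeriv :
    pderiv 0 (M.indepPolyDeriv S k) = M.indepPolyDeriv S (k + 1) := by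
  classical
  simp only [indepPolyDeriv, map_sum]
  refine Finset.sum_congr rfl fun I hI => ?_
  rw [pderiv_C_mul, pderiv_mul, pderiv_prod_X_of_notMem fun j _ => Fin.succ_ne_zero j, pderiv_pow,
    pderiv_X_self, Nat.descFactorial_succ, Nat.sub_add_eq]
  push_cast
  rw [C_mul, map_natCast C (n - I.card - k)]
  ring

lemma pderiv_succ_indepPolyDeriv {i : Fin n} (hi : i ∉ S) :
    pderiv i.succ (M.indepPolyDeriv S k) = M.indepPolyDeriv (insert i S) k := by
  classical
  simp only [indepPolyDeriv, map_sum]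
  have hX : ∀ e : ℕ, pderiv i.succ ((X 0 : MvPolynomial (Fin (n + 1)) ℝ) ^ e) = 0 := fun e => by
    rw [pderiv_pow, pderiv_X_of_ne (Fin.succ_ne_zero i).symm, mul_zero]
  symm
  refine Finset.sum_subset_zero_on_sdiff ?_ ?_ ?_
  · intro I hI
    simp only [Finset.mem_filter, Finset.mem_univ, true_and] at hI ⊢
    exact ⟨hI.1, (Finset.subset_insert _ _).trans hI.2⟩
  · intro I hI
    simp only [Finset.mem_sdiff, Finset.mem_filter, Finset.mem_univ, true_and, not_and] at hI
    have hiI : i ∉ I := fun h => hI.2 hI.1.1 (Finset.insert_subset h hI.1.2)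
    rw [pderiv_C_mul, pderiv_mul, hX, pderiv_prod_X_of_notMem]
    · simp
    · intro j hj h
      rw [Fin.succ_inj] at h
      subst h
      exact hiI (Finset.mem_sdiff.1 hj).1
  · intro I hI
    simp only [Finset.mem_filter, Finset.mem_univ, true_and] at hI
    have hiI : i ∈ I \ S := Finset.mem_sdiff.2 ⟨hI.2 (Finset.mem_insert_self _ _), hi⟩
    rw [pderiv_C_mul, pderiv_mul, hX, pderiv_prod_X (Fin.succ_injective n) hiI,
      ← Finset.sdiff_insert]
    simp

lemma pderiv_succ_indepPolyDeriv_of_mem {i : Fin n} (hi : i ∈ S) :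
    pderiv i.succ (M.indepPolyDeriv S k) = 0 := by
  classical
  simp only [indepPolyDeriv, map_sum]
  refine Finset.sum_eq_zero fun I hI => ?_
  rw [pderiv_C_mul, pderiv_mul, pderiv_pow, pderiv_X_of_ne (Fin.succ_ne_zero i).symm,
    pderiv_prod_X_of_notMem]
  · simp
  · intro j hj h
    rw [Fin.succ_inj] at h
    subst h
    exact (Finset.mem_sdiff.1 hj).2 hi

lemma reducedIndepPoly_eq : M.reducedIndepPoly ℝ = M.indepPolyDeriv ∅ (n - M.eRank.toNat) := by
  have h : ∀ k, (fun p => pderiv 0 p)^[k] (M.indepPoly ℝ) = M.indepPolyDeriv ∅ k := by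
    intro k
    induction k with
    | zero => exact indepPolyDeriv_empty_zero.symm
    | succ k ih => rw [Function.iterate_succ_apply', ih, pderiv_zero_indepPolyDeriv]
  exact h _

lemma isHomogeneous_indepPolyDeriv {m : ℕ} (hm : S.card + k + m = n) :
    (M.indepPolyDeriv S k).IsHomogeneous m := by
  classical
  refine IsHomogeneous.sum _ _ _ fun I hI => ?_
  obtain ⟨-, hSI⟩ := (Finset.mem_filter.1 hI).2
  have hIn : I.card ≤ n := by simpa using I.card_le_univ
  have hSI' := Finset.card_le_card hSI
  -- Truncated subtraction would spoil the degree count here, but the falling factorial is then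
  -- zero.
  by_cases hk : n - I.card < k
  · rw [Nat.descFactorial_of_lt hk]
    simpa using isHomogeneous_zero _ _ _
  · have h1 : (∏ i ∈ I \ S, (X i.succ : MvPolynomial (Fin (n + 1)) ℝ)).IsHomogeneous
        (∑ i ∈ I \ S, 1) := IsHomogeneous.prod _ _ _ fun i _ => isHomogeneous_X _ _
    have h2 := (isHomogeneous_C (Fin (n + 1)) (((n - I.card).descFactorial k : ℕ) : ℝ)).mul
      (h1.mul (isHomogeneous_X_pow (R := ℝ) (0 : Fin (n + 1)) (n - I.card - k)))
    convert h2 using 1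
    rw [Finset.sum_const, smul_eq_mul, mul_one, Finset.card_sdiff_of_subset hSI]
    omega

lemma eval_indepPolyDeriv_nonneg (h0 : 0 ≤ a 0) (ha : ∀ i : Fin n, 0 < a i.succ) :
    0 ≤ eval a (M.indepPolyDeriv S k) := by
  classical
  rw [indepPolyDeriv, map_sum]
  refine Finset.sum_nonneg fun I _ => ?_
  simp only [map_mul, map_prod, map_pow, eval_X, eval_C]
  have := Finset.prod_nonneg (s := I \ S) fun i _ => (ha i).le
  positivity

lemma eval_indepPolyDeriv_pos {I : Finset (Fin n)} (hI : M.Indep (I : Set (Fin n))) (hSI : S ⊆ I)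
    (hk : I.card + k ≤ n) (h0 : 0 ≤ a 0) (h0' : 0 < a 0 ∨ I.card + k = n)
    (ha : ∀ i : Fin n, 0 < a i.succ) : 0 < eval a (M.indepPolyDeriv S k) := by
  classical
  rw [indepPolyDeriv, map_sum]
  refine Finset.sum_pos' (fun I _ => ?_) ⟨I, Finset.mem_filter.2 ⟨Finset.mem_univ _, hI, hSI⟩, ?_⟩
  all_goals simp only [map_mul, map_prod, map_pow, eval_X, eval_C]
  · have := Finset.prod_nonneg (s := I \ S) fun i _ => (ha i).le
    positivity
  · have h1 := Finset.prod_pos (s := I \ S) fun i _ => ha i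
    have h2 : 0 < (n - I.card).descFactorial k := Nat.descFactorial_pos.2 (by omega)
    have h3 : 0 < a 0 ^ (n - I.card - k) := by
      rcases h0' with h | h
      · positivity
      · rw [show n - I.card - k = 0 by omega, pow_zero]; exact one_pos
    positivity

open Classical in
-- Any strictly larger `I ⊇ S` has `n - I.card < k`, so its falling factorial vanishes; only `I = S`
-- is left.
lemma eval_indepPolyDeriv_of_card (h : S.card + k = n) :
    eval a (M.indepPolyDeriv S k) = if M.Indep (S : Set (Fin n)) then (k.factorial : ℝ) else 0 := by
  split_ifs with hS
  · rw [indepPolyDeriv, map_sum, Finset.sum_eq_single S]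
    · rw [show n - S.card = k by omega, Nat.descFactorial_self]
      simp
    · intro I hI hne
      obtain ⟨-, hSI⟩ := (Finset.mem_filter.1 hI).2
      have := Finset.card_lt_card (hSI.ssubset_of_ne hne.symm)
      have hIn : I.card ≤ n := by simpa using I.card_le_univ
      rw [Nat.descFactorial_of_lt (by omega)]
      simp
    · intro h
      exact absurd (Finset.mem_filter.2 ⟨Finset.mem_univ _, hS, subset_rfl⟩) h
  · rw [indepPolyDeriv_eq_zero hS, map_zero]

end Matroid
end

/-! ### Quadratic derivatives and parallel classes of contractions -/

noncomputable section

open Matrix MvPolynomial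

/-- The adjacency form of a complete multipartite graph with parts the fibres of `φ`: the full
product minus the diagonal blocks. The parts will be parallel classes. -/
lemma Finset.sum_sum_ite_ne_mul {κ β : Type*} [DecidableEq β] (T : Finset κ) (φ : κ → β)
    [∀ i j, Decidable (φ i ≠ φ j)] (x y : κ → ℝ) :
    ∑ i ∈ T, ∑ j ∈ T, (if φ i ≠ φ j then x i * y j else 0) =
      (∑ i ∈ T, x i) * (∑ i ∈ T, y i) -
        ∑ p ∈ T.image φ, (∑ i ∈ T with φ i = p, x i) * (∑ i ∈ T with φ i = p, y i) := by
  have h1 : ∑ p ∈ T.image φ, (∑ i ∈ T with φ i = p, x i) * (∑ i ∈ T with φ i = p, y i) =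
      ∑ i ∈ T, ∑ j ∈ T, if φ i = φ j then x i * y j else 0 := by
    rw [← Finset.sum_fiberwise_of_maps_to (s := T) (t := T.image φ) (g := φ)
      fun i hi => Finset.mem_image_of_mem φ hi]
    refine Finset.sum_congr rfl fun p _ => ?_
    rw [Finset.sum_mul]
    refine Finset.sum_congr rfl fun i hi => ?_
    rw [Finset.mul_sum, Finset.sum_filter]
    refine Finset.sum_congr rfl fun j _ => ?_
    rw [(Finset.mem_filter.1 hi).2]
    simp only [eq_comm]
  rw [h1, Finset.sum_mul_sum, ← Finset.sum_sub_distrib]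
  refine Finset.sum_congr rfl fun i _ => ?_
  rw [← Finset.sum_sub_distrib]
  refine Finset.sum_congr rfl fun j _ => ?_
  by_cases h : φ i = φ j <;> simp [h]

/-- Cauchy–Schwarz for a positive semidefinite form; the cross terms assemble to `c` times a sum of
squares. -/
lemma Finset.add_mul_sq_le {β : Type*} (P : Finset β) (f g : β → ℝ) {c : ℝ} (hc : 0 ≤ c)
    (s t : ℝ) :
    (∑ p ∈ P, f p * g p + c * (s * t)) ^ 2 ≤
      (∑ p ∈ P, f p * f p + c * (s * s)) * (∑ p ∈ P, g p * g p + c * (t * t)) := by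
  have h1 : (∑ p ∈ P, f p * g p) ^ 2 ≤ (∑ p ∈ P, f p * f p) * ∑ p ∈ P, g p * g p := by
    simpa [sq] using Finset.sum_mul_sq_le_sq_mul_sq P f g
  have h2 : 0 ≤ ∑ p ∈ P, (f p * t - g p * s) ^ 2 := Finset.sum_nonneg fun p _ => sq_nonneg _
  have h3 : ∑ p ∈ P, (f p * t - g p * s) ^ 2 = t ^ 2 * ∑ p ∈ P, f p * f p
      - 2 * (s * t) * ∑ p ∈ P, f p * g p + s ^ 2 * ∑ p ∈ P, g p * g p := by
    rw [Finset.mul_sum, Finset.mul_sum, Finset.mul_sum, ← Finset.sum_sub_distrib,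
      ← Finset.sum_add_distrib]
    exact Finset.sum_congr rfl fun p _ => by ring
  rw [h3] at h2
  nlinarith [mul_nonneg hc h2]

namespace Matroid

variable {n : ℕ} {M : Matroid (Fin n)} {S : Finset (Fin n)} {k : ℕ} {a : Fin (n + 1) → ℝ}

open Classical in
/-- The nonloops of the contraction of `M` by `S`. -/
def contractNonloops (M : Matroid (Fin n)) (S : Finset (Fin n)) : Finset (Fin n) :=
  Finset.univ.filter fun i => i ∉ M.closure S

lemma mem_contractNonloops {i : Fin n} : i ∈ M.contractNonloops S ↔ i ∉ M.closure S := by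
  simp [contractNonloops]

lemma indep_insert_iff (hE : M.E = Set.univ) {I : Set (Fin n)} (hI : M.Indep I) {i : Fin n} :
    i ∉ I ∧ M.Indep (insert i I) ↔ i ∉ M.closure I := by
  constructor
  · rintro ⟨h1, h2⟩
    exact ((hI.insert_indep_iff_of_notMem h1).1 h2).2
  · intro h
    have h1 : i ∉ I := fun hi => h (M.mem_closure_of_mem hi hI.subset_ground)
    exact ⟨h1, (hI.insert_indep_iff_of_notMem h1).2 ⟨hE ▸ Set.mem_univ i, h⟩⟩

lemma mem_closure_insert_iff_of_notMem (hE : M.E = Set.univ) {I : Set (Fin n)} {i j : Fin n}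
    (hi : i ∉ M.closure I) :
    i ∈ M.closure (insert j I) ↔ M.closure (insert i I) = M.closure (insert j I) := by
  constructor
  · exact fun h => M.closure_insert_congr ⟨h, hi⟩
  · intro h
    rw [← h]
    exact M.mem_closure_of_mem (Set.mem_insert _ _) (by rw [hE]; exact Set.subset_univ _)

/-- In terms of `M / S`: a pair is independent exactly when its members are nonloops and not
parallel. This determines the support of the quadratic Hessian. -/
lemma indep_insert_insert_iff (hE : M.E = Set.univ) (hS : M.Indep (S : Set (Fin n)))
    {i j : Fin n} :
    (j ∉ S ∧ i ∉ insert j S ∧ M.Indep (insert i (insert j S) : Finset (Fin n))) ↔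
      i ∈ M.contractNonloops S ∧ j ∈ M.contractNonloops S ∧
        M.closure (insert i S) ≠ M.closure (insert j S) := by
  rw [mem_contractNonloops, mem_contractNonloops]
  push_cast
  constructor
  · rintro ⟨h1, h2, h3⟩
    have hjS : M.Indep (insert j (S : Set (Fin n))) := h3.subset (Set.subset_insert _ _)
    have hj := (indep_insert_iff hE hS).1 ⟨h1, hjS⟩
    have hi' := (indep_insert_iff hE hjS).1 ⟨by simpa using h2, h3⟩
    have hi : i ∉ M.closure S := fun h => hi' (M.closure_subset_closure (Set.subset_insert _ _) h)
    exact ⟨hi, hj, fun h => hi' ((mem_closure_insert_iff_of_notMem hE hi).2 h)⟩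
  · rintro ⟨hi, hj, h⟩
    obtain ⟨h1, hjS⟩ := (indep_insert_iff hE hS).2 hj
    have hi' : i ∉ M.closure (insert j (S : Set (Fin n))) := fun h' =>
      h ((mem_closure_insert_iff_of_notMem hE hi).1 h')
    obtain ⟨h2, h3⟩ := (indep_insert_iff hE hjS).2 hi'
    exact ⟨h1, by simpa using h2, h3⟩

lemma hessianAt_zero_zero (hS : M.Indep (S : Set (Fin n)))
    (hk : S.card + (k + 2) = n) :
    (M.indepPolyDeriv S k).hessianAt a 0 0 = ((k + 2) * (k + 1) * k.factorial : ℝ) := by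
  rw [hessianAt_apply, pderiv_zero_indepPolyDeriv, pderiv_zero_indepPolyDeriv,
    eval_indepPolyDeriv_of_card (by omega), if_pos hS, Nat.factorial_succ, Nat.factorial_succ]
  push_cast
  ring

open Classical in
lemma hessianAt_zero_succ (hE : M.E = Set.univ) (hS : M.Indep (S : Set (Fin n)))
    (hk : S.card + (k + 2) = n) (i : Fin n) :
    (M.indepPolyDeriv S k).hessianAt a 0 i.succ =
      if i ∈ M.contractNonloops S then ((k + 1) * k.factorial : ℝ) else 0 := by
  have h := indep_insert_iff hE hS (i := i)
  rw [← mem_contractNonloops] at h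
  rw [hessianAt_apply]
  by_cases hi : i ∈ S
  · rw [pderiv_succ_indepPolyDeriv_of_mem hi, if_neg]
    · simp
    · rw [← h]; tauto
  · rw [pderiv_succ_indepPolyDeriv hi, pderiv_zero_indepPolyDeriv, eval_indepPolyDeriv_of_card
      (by rw [Finset.card_insert_of_notMem hi]; omega), Nat.factorial_succ]
    push_cast
    refine if_congr ?_ rfl rfl
    rw [← h]
    simp [hi]

open Classical in
lemma hessianAt_succ_succ (hE : M.E = Set.univ) (hS : M.Indep (S : Set (Fin n)))
    (hk : S.card + (k + 2) = n) (i j : Fin n) :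
    (M.indepPolyDeriv S k).hessianAt a i.succ j.succ =
      if i ∈ M.contractNonloops S ∧ j ∈ M.contractNonloops S ∧
        M.closure (insert i S) ≠ M.closure (insert j S) then (k.factorial : ℝ) else 0 := by
  have h := indep_insert_insert_iff hE hS (i := i) (j := j)
  rw [hessianAt_apply]
  by_cases hj : j ∈ S
  · rw [pderiv_succ_indepPolyDeriv_of_mem hj, if_neg]
    · simp
    · rw [← h]; tauto
  rw [pderiv_succ_indepPolyDeriv hj]
  by_cases hi : i ∈ insert j S
  · rw [pderiv_succ_indepPolyDeriv_of_mem hi, if_neg]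
    · simp
    · rw [← h]; tauto
  rw [pderiv_succ_indepPolyDeriv hi, eval_indepPolyDeriv_of_card
    (by rw [Finset.card_insert_of_notMem hi, Finset.card_insert_of_notMem hj]; omega)]
  refine if_congr ?_ rfl rfl
  rw [← h]
  tauto

open Classical in
/-- The parallel classes of the contraction of `M` by `S`, each represented by the closure of its
union with `S`. -/
def contractClasses (M : Matroid (Fin n)) (S : Finset (Fin n)) : Finset (Set (Fin n)) :=
  (M.contractNonloops S).image fun i => M.closure (insert i S)

open Classical in
/-- The sum of the coordinates of `v` over a parallel class of the contraction of `M` by `S`. -/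
def classSum (M : Matroid (Fin n)) (S : Finset (Fin n)) (v : Fin (n + 1) → ℝ)
    (p : Set (Fin n)) : ℝ :=
  ∑ i ∈ M.contractNonloops S with M.closure (insert i S) = p, v i.succ

/-- The total sum of the linear forms in `Matroid.classForm`. -/
def totalForm (M : Matroid (Fin n)) (S : Finset (Fin n)) (k : ℕ) (v : Fin (n + 1) → ℝ) : ℝ :=
  ∑ i ∈ M.contractNonloops S, v i.succ + (k + 2) * v 0

/-- The positive semidefinite form complementing the square of `Matroid.totalForm` in the Hessian of
a quadratic derivative of the independent set generating polynomial. -/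
def classForm (M : Matroid (Fin n)) (S : Finset (Fin n)) (k : ℕ) (v w : Fin (n + 1) → ℝ) : ℝ :=
  ∑ p ∈ M.contractClasses S, (M.classSum S v p + v 0) * (M.classSum S w p + w 0) +
    (k + 2 - (M.contractClasses S).card) * (v 0 * w 0)

lemma card_contractNonloops_le (hE : M.E = Set.univ) (hk : S.card + k = n) :
    (M.contractNonloops S).card ≤ k := by
  classical
  have h : M.contractNonloops S ⊆ Sᶜ := by
    intro i hi
    rw [Finset.mem_compl]
    intro h
    exact mem_contractNonloops.1 hi
      (M.mem_closure_of_mem (Finset.mem_coe.2 h) (by rw [hE]; exact Set.subset_univ _))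
  have := Finset.card_le_card h
  rw [Finset.card_compl, Fintype.card_fin] at this
  omega

lemma card_contractClasses_le (hE : M.E = Set.univ) (hk : S.card + k = n) :
    (M.contractClasses S).card ≤ k :=
  Finset.card_image_le.trans (card_contractNonloops_le hE hk)

lemma sum_classSum (v : Fin (n + 1) → ℝ) :
    ∑ p ∈ M.contractClasses S, M.classSum S v p = ∑ i ∈ M.contractNonloops S, v i.succ := by
  classical
  exact Finset.sum_fiberwise_of_maps_to (fun i hi => Finset.mem_image_of_mem _ hi) _

/-- Up to `k!`, the entries are `(k + 2)(k + 1)` at the corner, `k + 1` between `x_0` and a nonloop,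
and `1` between nonparallel nonloops. Completing the square in `x_0` gives the identity. -/
lemma dotProduct_hessianAt_mulVec_eq (hE : M.E = Set.univ)
    (hS : M.Indep (S : Set (Fin n))) (hk : S.card + (k + 2) = n) (v w : Fin (n + 1) → ℝ) :
    v ⬝ᵥ (M.indepPolyDeriv S k).hessianAt a *ᵥ w =
      k.factorial * (M.totalForm S k v * M.totalForm S k w - M.classForm S k v w) := by
  classical
  have h0 : ∀ i : Fin n, (M.indepPolyDeriv S k).hessianAt a i.succ 0 =
      if i ∈ M.contractNonloops S then ((k + 1) * k.factorial : ℝ) else 0 := fun i => by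
    rw [← hessianAt_zero_succ hE hS hk (a := a)]
    exact (isSymm_hessianAt _ _).apply _ _
  have h1 : ∑ i : Fin n, ∑ j : Fin n, v i.succ *
      ((M.indepPolyDeriv S k).hessianAt a i.succ j.succ * w j.succ) = k.factorial *
      ∑ i ∈ M.contractNonloops S, ∑ j ∈ M.contractNonloops S,
        if M.closure (insert i S) ≠ M.closure (insert j S) then v i.succ * w j.succ else 0 := by
    rw [Finset.mul_sum, ← Finset.sum_subset (Finset.subset_univ (M.contractNonloops S))]
    · refine Finset.sum_congr rfl fun i hi => ?_
      rw [Finset.mul_sum, ← Finset.sum_subset (Finset.subset_univ (M.contractNonloops S))]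
      · refine Finset.sum_congr rfl fun j hj => ?_
        rw [hessianAt_succ_succ hE hS hk]
        simp only [hi, hj, true_and]
        split_ifs <;> ring
      · intro j _ hj
        rw [hessianAt_succ_succ hE hS hk, if_neg (by tauto)]
        ring
    · intro i _ hi
      refine Finset.sum_eq_zero fun j _ => ?_
      rw [hessianAt_succ_succ hE hS hk, if_neg (by tauto)]
      ring
  have h2 : ∀ x : Fin (n + 1) → ℝ, ∑ i : Fin n,
      (if i ∈ M.contractNonloops S then ((k + 1) * k.factorial : ℝ) else 0) * x i.succ =
        (k + 1) * k.factorial * ∑ i ∈ M.contractNonloops S, x i.succ := by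
    intro x
    rw [Finset.mul_sum]
    simp [ite_mul, Finset.sum_ite_mem]
  have h3 : v ⬝ᵥ (M.indepPolyDeriv S k).hessianAt a *ᵥ w =
      (k + 2) * (k + 1) * k.factorial * (v 0 * w 0) +
      v 0 * ((k + 1) * k.factorial * ∑ i ∈ M.contractNonloops S, w i.succ) +
      w 0 * ((k + 1) * k.factorial * ∑ i ∈ M.contractNonloops S, v i.succ) +
      ∑ i : Fin n, ∑ j : Fin n, v i.succ *
      ((M.indepPolyDeriv S k).hessianAt a i.succ j.succ * w j.succ) := by
    rw [← h2, ← h2]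
    simp only [dotProduct, mulVec, Fin.sum_univ_succ, hessianAt_zero_zero hS hk, h0,
      hessianAt_zero_succ hE hS hk, mul_add, Finset.sum_add_distrib, Finset.mul_sum]
    have : ∀ i : Fin n, v i.succ * ((if i ∈ M.contractNonloops S then
        ((k + 1) * k.factorial : ℝ) else 0) * w 0) = w 0 * ((if i ∈ M.contractNonloops S then
        ((k + 1) * k.factorial : ℝ) else 0) * v i.succ) := fun i => by ring
    simp only [this]
    ring
  rw [h3, h1, Finset.sum_sum_ite_ne_mul (M.contractNonloops S) (fun i => M.closure (insert i S))
    (fun i => v i.succ) fun j => w j.succ]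
  have h4 : M.classForm S k v w =
      ∑ p ∈ M.contractClasses S, M.classSum S v p * M.classSum S w p +
      w 0 * ∑ i ∈ M.contractNonloops S, v i.succ + v 0 * ∑ i ∈ M.contractNonloops S, w i.succ +
      (k + 2) * (v 0 * w 0) := by
    rw [classForm, ← sum_classSum, ← sum_classSum, Finset.mul_sum, Finset.mul_sum, sub_mul,
      ← nsmul_eq_mul (M.contractClasses S).card, ← Finset.sum_const, ← add_sub_assoc]
    rw [← sub_eq_zero]
    have : ∑ p ∈ M.contractClasses S, (M.classSum S v p + v 0) * (M.classSum S w p + w 0) =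
        ∑ p ∈ M.contractClasses S, M.classSum S v p * M.classSum S w p +
        ∑ p ∈ M.contractClasses S, w 0 * M.classSum S v p +
        ∑ p ∈ M.contractClasses S, v 0 * M.classSum S w p +
        ∑ p ∈ M.contractClasses S, v 0 * w 0 := by
      simp only [← Finset.sum_add_distrib]
      exact Finset.sum_congr rfl fun p _ => by ring
    rw [this]
    ring
  rw [h4, totalForm, totalForm]
  simp only [contractClasses, classSum]
  ring

lemma classForm_mul_self_le (hE : M.E = Set.univ) (hk : S.card + (k + 2) = n)
    (v w : Fin (n + 1) → ℝ) :
    M.classForm S k v w ^ 2 ≤ M.classForm S k v v * M.classForm S k w w := by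
  refine Finset.add_mul_sq_le _ _ _ ?_ _ _
  have := card_contractClasses_le hE hk
  rw [sub_nonneg]
  exact_mod_cast this

/-- For `v` orthogonal to `a`, Cauchy–Schwarz for the class form reads `A²V² ≤ αβ`. Since `α < A²`,
it forces `V² ≤ β`. -/
lemma reverseCS_hessianAt_quadratic (hE : M.E = Set.univ)
    (hS : M.Indep (S : Set (Fin n))) (hk : S.card + (k + 2) = n)
    (ha : 0 < a ⬝ᵥ (M.indepPolyDeriv S k).hessianAt a *ᵥ a) :
    ((M.indepPolyDeriv S k).hessianAt a).ReverseCS a := by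
  refine reverseCS_of_forall_orthogonal (isSymm_hessianAt _ _) ha fun v hv => ?_
  have hf : (0 : ℝ) < k.factorial := by exact_mod_cast k.factorial_pos
  rw [dotProduct_hessianAt_mulVec_eq hE hS hk] at ha hv ⊢
  have h1 := (mul_eq_zero.1 hv).resolve_left hf.ne'
  have h2 := pos_of_mul_pos_right ha hf.le
  have h3 := classForm_mul_self_le hE hk a v
  refine mul_nonpos_of_nonneg_of_nonpos hf.le ?_
  have h4 : M.classForm S k a v = M.totalForm S k a * M.totalForm S k v := by linarith
  have h0 : 0 ≤ M.classForm S k a a := by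
    have := card_contractClasses_le hE hk
    have : ((M.contractClasses S).card : ℝ) ≤ k + 2 := by exact_mod_cast this
    exact add_nonneg (Finset.sum_nonneg fun p _ => mul_self_nonneg _)
      (mul_nonneg (by linarith) (mul_self_nonneg _))
  have h0' : 0 ≤ M.classForm S k v v := by
    have := card_contractClasses_le hE hk
    have : ((M.contractClasses S).card : ℝ) ≤ k + 2 := by exact_mod_cast this
    exact add_nonneg (Finset.sum_nonneg fun p _ => mul_self_nonneg _)
      (mul_nonneg (by linarith) (mul_self_nonneg _))
  rw [h4] at h3
  set A := M.totalForm S k a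
  set V := M.totalForm S k v
  set α := M.classForm S k a a
  set β := M.classForm S k v v
  by_contra hcon
  push Not at hcon
  have : 0 < A * A := by linarith
  nlinarith

/-- For a kernel vector `β = V²`, so `A²V² ≤ αV²` with `α < A²` gives `V = 0`. The class form then
vanishes at `v`, and both of its nonnegative parts do. -/
lemma classSum_of_hessianAt_mulVec_eq_zero (hE : M.E = Set.univ)
    (hS : M.Indep (S : Set (Fin n))) (hk : S.card + (k + 2) = n)
    (ha : 0 < a ⬝ᵥ (M.indepPolyDeriv S k).hessianAt a *ᵥ a) {v : Fin (n + 1) → ℝ}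
    (hv : (M.indepPolyDeriv S k).hessianAt a *ᵥ v = 0) :
    (∀ p ∈ M.contractClasses S, M.classSum S v p + v 0 = 0) ∧
      (v 0 ≠ 0 → (M.contractClasses S).card = k + 2) := by
  have hf : (0 : ℝ) < k.factorial := by exact_mod_cast k.factorial_pos
  have hav : a ⬝ᵥ (M.indepPolyDeriv S k).hessianAt a *ᵥ v = 0 := by rw [hv, dotProduct_zero]
  have hvv : v ⬝ᵥ (M.indepPolyDeriv S k).hessianAt a *ᵥ v = 0 := by rw [hv, dotProduct_zero]
  rw [dotProduct_hessianAt_mulVec_eq hE hS hk] at ha hav hvv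
  have h1 := (mul_eq_zero.1 hav).resolve_left hf.ne'
  have h1' := (mul_eq_zero.1 hvv).resolve_left hf.ne'
  have h2 := pos_of_mul_pos_right ha hf.le
  have h3 := classForm_mul_self_le hE hk a v
  have h4 : M.classForm S k a v = M.totalForm S k a * M.totalForm S k v := by linarith
  have h4' : M.classForm S k v v = M.totalForm S k v * M.totalForm S k v := by linarith
  have hc : ((M.contractClasses S).card : ℝ) ≤ k + 2 := by
    exact_mod_cast card_contractClasses_le hE hk
  have hs : 0 ≤ ∑ p ∈ M.contractClasses S, (M.classSum S v p + v 0) * (M.classSum S v p + v 0) :=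
    Finset.sum_nonneg fun p _ => mul_self_nonneg _
  have ht : 0 ≤ (k + 2 - (M.contractClasses S).card : ℝ) * (v 0 * v 0) :=
    mul_nonneg (by linarith) (mul_self_nonneg _)
  have h0 : M.classForm S k v v = 0 := by
    rw [h4, h4'] at h3
    rw [h4']
    nlinarith [mul_self_nonneg (M.totalForm S k v)]
  rw [classForm] at h0
  constructor
  · intro p hp
    have := (Finset.sum_eq_zero_iff_of_nonneg fun p _ => mul_self_nonneg _).1
      (show ∑ p ∈ M.contractClasses S, (M.classSum S v p + v 0) * (M.classSum S v p + v 0) = 0 by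
        linarith) p hp
    exact mul_self_eq_zero.1 this
  · intro hv0
    have := (mul_eq_zero.1 (show (k + 2 - (M.contractClasses S).card : ℝ) * (v 0 * v 0) = 0 by
      linarith)).resolve_right (mul_self_ne_zero.2 hv0)
    have : ((M.contractClasses S).card : ℝ) = k + 2 := by linarith
    exact_mod_cast this

end Matroid
end

/-! ### Induction on the degree, and the kernel of the Hessian -/

noncomputable section

open Matrix MvPolynomial

lemma MvPolynomial.continuous_dotProduct_hessianAt_mulVec {ι : Type*} [Fintype ι]
    (p : MvPolynomial ι ℝ) {g x y : ℝ → ι → ℝ} (hg : Continuous g) (hx : Continuous x)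
    (hy : Continuous y) : Continuous fun t => x t ⬝ᵥ p.hessianAt (g t) *ᵥ y t := by
  refine hx.dotProduct (Continuous.matrix_mulVec ?_ hy)
  refine continuous_matrix fun i j => ?_
  exact (MvPolynomial.continuous_eval _).comp hg

namespace Matroid

variable {n r : ℕ} {M : Matroid (Fin n)} {S : Finset (Fin n)} {k : ℕ} {a : Fin (n + 1) → ℝ}

lemma pderiv_indepPolyDeriv_cases (S : Finset (Fin n)) (k : ℕ) (i : Fin (n + 1)) :
    pderiv i (M.indepPolyDeriv S k) = 0 ∨
      ∃ S' k', S'.card + k' = S.card + k + 1 ∧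
        pderiv i (M.indepPolyDeriv S k) = M.indepPolyDeriv S' k' := by
  refine Fin.cases ?_ (fun i => ?_) i
  · exact Or.inr ⟨S, k + 1, by omega, pderiv_zero_indepPolyDeriv⟩
  · by_cases hi : i ∈ S
    · exact Or.inl (pderiv_succ_indepPolyDeriv_of_mem hi)
    · refine Or.inr ⟨insert i S, k, ?_, pderiv_succ_indepPolyDeriv hi⟩
      rw [Finset.card_insert_of_notMem hi]; omega

lemma hessianAt_indepPolyDeriv_nonneg (h0 : 0 ≤ a 0) (ha : ∀ i : Fin n, 0 < a i.succ)
    (i j : Fin (n + 1)) : 0 ≤ (M.indepPolyDeriv S k).hessianAt a i j := by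
  rw [hessianAt_apply]
  rcases M.pderiv_indepPolyDeriv_cases S k j with h | ⟨S', k', -, h⟩
  · rw [h]; simp
  rw [h]
  rcases M.pderiv_indepPolyDeriv_cases S' k' i with h | ⟨S', k', -, h⟩
  · rw [h]; simp
  rw [h]
  exact eval_indepPolyDeriv_nonneg h0 ha

/-- Row `x_0` plays the distinguished row `o`: as `a_0 > 0`, the derivative `∂_0 ∂_i` is positive at
`a` unless `∂_i` already vanishes identically. -/
lemma reverseCS_hessianAt_of_pos (hE : M.E = Set.univ) (ha : ∀ i, 0 < a i) (m : ℕ) :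
    ∀ {S : Finset (Fin n)} {k : ℕ}, S.card + k + (m + 2) = n →
      ((M.indepPolyDeriv S k).hessianAt a).ReverseCS a := by
  induction m with
  | zero =>
    intro S k hk
    by_cases hS : M.Indep (S : Set (Fin n))
    · refine reverseCS_hessianAt_quadratic hE hS (by omega) ?_
      rw [(isHomogeneous_indepPolyDeriv hk).dotProduct_hessianAt_mulVec]
      have := eval_indepPolyDeriv_pos hS subset_rfl (k := k) (by omega) (ha 0).le (Or.inl (ha 0))
        fun i => ha i.succ
      positivity
    · rw [indepPolyDeriv_eq_zero hS, hessianAt_zero]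
      exact reverseCS_zero a
  | succ m ih =>
    intro S k hk
    by_cases hS : M.Indep (S : Set (Fin n))
    · refine (isHomogeneous_indepPolyDeriv (m := m + 3) (by omega)).reverseCS_hessianAt ha ?_
        (hessianAt_indepPolyDeriv_nonneg (ha 0).le fun i => ha i.succ) (o := 0) ?_ ?_
      · exact eval_indepPolyDeriv_pos hS subset_rfl (by omega) (ha 0).le (Or.inl (ha 0))
          fun i => ha i.succ
      · refine Fin.cases ?_ fun i => ?_
        · left
          rw [hessianAt_apply, pderiv_zero_indepPolyDeriv, pderiv_zero_indepPolyDeriv]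
          exact eval_indepPolyDeriv_pos hS subset_rfl (by omega) (ha 0).le (Or.inl (ha 0))
            fun i => ha i.succ
        · rw [hessianAt_apply]
          by_cases hi : i ∈ S
          · exact Or.inr (pderiv_succ_indepPolyDeriv_of_mem hi)
          rw [pderiv_succ_indepPolyDeriv hi, pderiv_zero_indepPolyDeriv]
          by_cases hiS : M.Indep (insert i S : Finset (Fin n))
          · left
            refine eval_indepPolyDeriv_pos hiS subset_rfl ?_ (ha 0).le (Or.inl (ha 0))
              fun i => ha i.succ
            rw [Finset.card_insert_of_notMem hi]
            omega
          · exact Or.inr (indepPolyDeriv_eq_zero hiS)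
      · intro i
        rcases M.pderiv_indepPolyDeriv_cases S k i with h | ⟨S', k', h', h⟩
        · rw [h, hessianAt_zero]
          exact reverseCS_zero a
        · rw [h]
          exact ih (by omega)
    · rw [indepPolyDeriv_eq_zero hS, hessianAt_zero]
      exact reverseCS_zero a

lemma reverseCS_hessianAt (hE : M.E = Set.univ) (h0 : 0 ≤ a 0) (ha : ∀ i : Fin n, 0 < a i.succ)
    {m : ℕ} (hk : S.card + k + (m + 2) = n) :
    ((M.indepPolyDeriv S k).hessianAt a).ReverseCS a := by
  intro v
  -- Shift `a_0` to `a_0 + t` with `t > 0` and let `t` tend to `0`; the inequality is a closed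
  -- condition.
  set g : ℝ → Fin (n + 1) → ℝ := fun t => Function.update a 0 (a 0 + t) with hg
  have hgc : Continuous g := continuous_const.update 0 (by fun_prop)
  have hg0 : g 0 = a := by simp [hg]
  have hvc : Continuous fun _ : ℝ => v := continuous_const
  set p := M.indepPolyDeriv S k
  have h1 : Continuous fun t => (g t ⬝ᵥ p.hessianAt (g t) *ᵥ g t) *
      (v ⬝ᵥ p.hessianAt (g t) *ᵥ v) :=
    (p.continuous_dotProduct_hessianAt_mulVec hgc hgc hgc).mul
      (p.continuous_dotProduct_hessianAt_mulVec hgc hvc hvc)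
  have h2 : Continuous fun t => (g t ⬝ᵥ p.hessianAt (g t) *ᵥ v) ^ 2 :=
    (p.continuous_dotProduct_hessianAt_mulVec hgc hgc hvc).pow 2
  have h3 : ∀ᶠ t in nhdsWithin (0 : ℝ) (Set.Ioi 0), (g t ⬝ᵥ p.hessianAt (g t) *ᵥ g t) *
      (v ⬝ᵥ p.hessianAt (g t) *ᵥ v) ≤ (g t ⬝ᵥ p.hessianAt (g t) *ᵥ v) ^ 2 := by
    filter_upwards [self_mem_nhdsWithin] with t ht
    refine reverseCS_hessianAt_of_pos hE (fun i => ?_) m hk v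
    refine Fin.cases ?_ (fun i => ?_) i
    · simp only [hg, Function.update_self]
      have : 0 < t := ht
      linarith
    · simp only [hg, Function.update_of_ne (Fin.succ_ne_zero i)]
      exact ha i
  have h4 := le_of_tendsto_of_tendsto (h1.continuousWithinAt (s := Set.Ioi 0) (x := 0))
    (h2.continuousWithinAt (s := Set.Ioi 0) (x := 0)) h3
  simpa only [hg0] using h4

lemma exists_finset_isBase_superset (hr : M.eRank = r) (hS : M.Indep (S : Set (Fin n))) :
    ∃ B : Finset (Fin n), M.IsBase (B : Set (Fin n)) ∧ S ⊆ B ∧ B.card = r := by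
  obtain ⟨B, hB, hSB⟩ := hS.exists_isBase_superset
  lift B to Finset (Fin n) using B.toFinite
  refine ⟨B, hB, Finset.coe_subset.1 hSB, ?_⟩
  have := hB.encard_eq_eRank
  rw [hr, Set.encard_coe_eq_coe_finsetCard] at this
  exact_mod_cast this

lemma exists_finset_indep_superset (hr : M.eRank = r) (hS : M.Indep (S : Set (Fin n))) {d : ℕ}
    (hd : S.card ≤ d) (hdr : d ≤ r) :
    ∃ I : Finset (Fin n), M.Indep (I : Set (Fin n)) ∧ S ⊆ I ∧ I.card = d := by
  obtain ⟨B, hB, hSB, hBr⟩ := exists_finset_isBase_superset hr hS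
  obtain ⟨I, hSI, hIB, hI⟩ := Finset.exists_subsuperset_card_eq hSB hd (hBr ▸ hdr)
  exact ⟨I, hB.indep.subset (Finset.coe_subset.2 hIB), hSI, hI⟩

lemma rank_le (hr : M.eRank = r) : r ≤ n := by
  obtain ⟨I, -, -, hI⟩ := exists_finset_indep_superset (S := ∅) (d := r) hr (by simp) (by simp)
    le_rfl
  rw [← hI]
  simpa using I.card_le_univ

/-- When `n - k ≤ r`, some independent set of size `n - k` contains `S`. Its term is free of `x_0`,
which gives positivity even at `a_0 = 0`. -/
lemma eval_indepPolyDeriv_pos_of_card_le (hr : M.eRank = r) (hS : M.Indep (S : Set (Fin n)))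
    (hk : n ≤ r + k) (hk' : S.card + k ≤ n) (h0 : 0 ≤ a 0) (ha : ∀ i : Fin n, 0 < a i.succ) :
    0 < eval a (M.indepPolyDeriv S k) := by
  obtain ⟨I, hI, hSI, hd⟩ := exists_finset_indep_superset (d := n - k) hr hS (by omega) (by omega)
  exact eval_indepPolyDeriv_pos hI hSI (by omega) h0 (Or.inr (by omega)) ha

lemma dotProduct_hessianAt_mulVec_pos (hr : M.eRank = r) (hS : M.Indep (S : Set (Fin n)))
    (hk : n ≤ r + k) {m : ℕ} (hk' : S.card + k + (m + 2) = n) (h0 : 0 ≤ a 0)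
    (ha : ∀ i : Fin n, 0 < a i.succ) : 0 < a ⬝ᵥ (M.indepPolyDeriv S k).hessianAt a *ᵥ a := by
  rw [(isHomogeneous_indepPolyDeriv hk').dotProduct_hessianAt_mulVec]
  have := eval_indepPolyDeriv_pos_of_card_le hr hS hk (by omega) h0 ha
  positivity

/-- The descent differentiates only in the variables of `S`, which are positive at `a`; `a_0` may be
zero. -/
lemma hessianAt_mulVec_eq_zero_of_empty (hE : M.E = Set.univ) (hr : M.eRank = r) (h0 : 0 ≤ a 0)
    (ha : ∀ i : Fin n, 0 < a i.succ) {v : Fin (n + 1) → ℝ}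
    (hv : (M.indepPolyDeriv ∅ (n - r)).hessianAt a *ᵥ v = 0)
    (hS : M.Indep (S : Set (Fin n))) (hSr : S.card + 2 ≤ r) :
    (M.indepPolyDeriv S (n - r)).hessianAt a *ᵥ v = 0 := by
  have hrn := rank_le hr
  induction S using Finset.induction_on with
  | empty => exact hv
  | insert i S hi ih =>
    rw [Finset.card_insert_of_notMem hi] at hSr
    have hS' : M.Indep (S : Set (Fin n)) := hS.subset (by simp)
    obtain ⟨m, rfl⟩ : ∃ m, r = S.card + 3 + m := ⟨r - (S.card + 3), by omega⟩
    rw [← pderiv_succ_indepPolyDeriv hi]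
    refine IsHomogeneous.hessianAt_pderiv_mulVec_eq_zero (m := m)
      (isHomogeneous_indepPolyDeriv (by omega)) (Fin.cases h0 fun i => (ha i).le) ?_ ?_
      (ih hS' (by omega)) (ha i)
    · refine Fin.cases ?_ fun j => ?_
      · left
        rw [pderiv_zero_indepPolyDeriv]
        exact eval_indepPolyDeriv_pos_of_card_le hr hS' (by omega) (by omega) h0 ha
      · by_cases hj : j ∈ S
        · exact Or.inr (pderiv_succ_indepPolyDeriv_of_mem hj)
        rw [pderiv_succ_indepPolyDeriv hj]
        by_cases hjS : M.Indep (insert j S : Finset (Fin n))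
        · left
          refine eval_indepPolyDeriv_pos_of_card_le hr hjS (by omega) ?_ h0 ha
          rw [Finset.card_insert_of_notMem hj]
          omega
        · exact Or.inr (indepPolyDeriv_eq_zero hjS)
    · intro j
      rcases M.pderiv_indepPolyDeriv_cases S (n - (S.card + 3 + m)) j with h | ⟨S', k', h', h⟩
      · rw [h, hessianAt_zero]
        exact reverseCS_zero a
      · rw [h]
        exact reverseCS_hessianAt hE h0 ha (m := m) (by omega)

lemma isUniform_of_forall_indep_insert_insert (hr : M.eRank = r) (h2 : 2 ≤ r) (h : ∀ S : Finset (Fin n), M.Indep (S : Set (Fin n)) → S.card + 2 = r → ∀ i j, i ≠ j → i ∉ S →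
      j ∉ S → M.Indep (insert i (insert j S) : Finset (Fin n))) : M.IsUniform := by
  have hrn := rank_le hr
  have key : ∀ S : Finset (Fin n), S.card + 2 ≤ r → M.Indep (S : Set (Fin n)) := by
    intro S
    induction S using Finset.induction_on with
    | empty => simp
    | insert i S hi ih =>
      intro hS
      rw [Finset.card_insert_of_notMem hi] at hS
      -- Grow `S` to size `r - 2`, where `h` allows adjoining `i` along with an arbitrary further
      -- element `j`.
      obtain ⟨I, hI, hSI, hIr⟩ := exists_finset_indep_superset (d := r - 2) hr
        (ih (by omega)) (by omega) (by omega)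
      by_cases hiI : i ∈ I
      · exact hI.subset (Finset.coe_subset.2 (Finset.insert_subset hiI hSI))
      · obtain ⟨j, -, hj⟩ := Finset.exists_mem_notMem_of_card_lt_card
          (s := insert i I) (t := Finset.univ)
          (by rw [Finset.card_insert_of_notMem hiI, Finset.card_univ, Fintype.card_fin]; omega)
        rw [Finset.mem_insert, not_or] at hj
        refine (h I hI (by omega) i j (Ne.symm hj.1) hiI hj.2).subset (Finset.coe_subset.2 ?_)
        exact Finset.insert_subset_insert _ (hSI.trans (Finset.subset_insert _ _))
  refine ⟨r, fun B _ => ⟨fun hB => by rw [hB.encard_eq_eRank, hr], fun hB => ?_⟩⟩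
  lift B to Finset (Fin n) using B.toFinite
  rw [Set.encard_coe_eq_coe_finsetCard] at hB
  have hB' : B.card = r := by exact_mod_cast hB
  obtain ⟨i, hi⟩ : B.Nonempty := Finset.card_pos.1 (by omega)
  have hci := Finset.card_erase_of_mem hi
  obtain ⟨j, hj⟩ : (B.erase i).Nonempty := Finset.card_pos.1 (by omega)
  have hcj := Finset.card_erase_of_mem hj
  have hBI : M.Indep (B : Set (Fin n)) := by
    have := h ((B.erase i).erase j) (key _ (by omega)) (by omega) i j
      (Finset.ne_of_mem_erase hj).symm (by simp) (by simp)
    rwa [Finset.insert_erase hj, Finset.insert_erase hi] at this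
  refine hBI.isBase_of_eRk_ge B.finite_toSet ?_
  rw [hBI.eRk_eq_encard, hr, Set.encard_coe_eq_coe_finsetCard, hB']

/-- If `v_0 ≠ 0`, there are `n - |S|` parallel classes in `M / S`. So all elements outside `S` are
nonloops, no two of them parallel, for each independent `S` of size `r - 2`. -/
lemma apply_zero_eq_zero_of_not_isUniform (hE : M.E = Set.univ) (hr : M.eRank = r) (h2 : 2 ≤ r)
    (hM : ¬ M.IsUniform) (h0 : 0 ≤ a 0) (ha : ∀ i : Fin n, 0 < a i.succ) {v : Fin (n + 1) → ℝ}
    (hv : (M.indepPolyDeriv ∅ (n - r)).hessianAt a *ᵥ v = 0) : v 0 = 0 := by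
  classical
  have hrn := rank_le hr
  by_contra hv0
  refine hM (isUniform_of_forall_indep_insert_insert hr h2 fun S hS hSr i j hij hi hj => ?_)
  have hk : S.card + (n - r + 2) = n := by omega
  have hc := (classSum_of_hessianAt_mulVec_eq_zero hE hS hk
    (dotProduct_hessianAt_mulVec_pos hr hS (by omega) (m := 0) (by omega) h0 ha)
    (hessianAt_mulVec_eq_zero_of_empty hE hr h0 ha hv hS (by omega))).2 hv0
  have hN := card_contractNonloops_le hE hk
  have hle : (M.contractClasses S).card ≤ (M.contractNonloops S).card := Finset.card_image_le
  have hinj := Finset.card_image_iff.1 (show ((M.contractNonloops S).image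
    fun i => M.closure (insert i S)).card = (M.contractNonloops S).card by
      change (M.contractClasses S).card = _; omega)
  have hsub : M.contractNonloops S = Sᶜ := by
    refine Finset.eq_of_subset_of_card_le (fun i hi => ?_) ?_
    · rw [Finset.mem_compl]
      intro h
      exact mem_contractNonloops.1 hi
        (M.mem_closure_of_mem (Finset.mem_coe.2 h) (by rw [hE]; exact Set.subset_univ _))
    · rw [Finset.card_compl, Fintype.card_fin]
      omega
  have hi' : i ∈ M.contractNonloops S := by rw [hsub]; exact Finset.mem_compl.2 hi
  have hj' : j ∈ M.contractNonloops S := by rw [hsub]; exact Finset.mem_compl.2 hj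
  exact ((indep_insert_insert_iff hE hS).2
    ⟨hi', hj', fun h => hij (hinj (Finset.mem_coe.2 hi') (Finset.mem_coe.2 hj') h)⟩).2.2

open Classical in
/-- The sum of the coordinates of `v` over a set of elements of the matroid. -/
def setSum (v : Fin (n + 1) → ℝ) (F : Set (Fin n)) : ℝ :=
  ∑ i with i ∈ F, v i.succ

open Classical in
lemma setSum_sub {v : Fin (n + 1) → ℝ} {F G : Set (Fin n)} (h : G ⊆ F) :
    setSum v F - setSum v G = ∑ i with i ∈ F ∧ i ∉ G, v i.succ := by
  rw [sub_eq_iff_eq_add', setSum, setSum, ← Finset.sum_union]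
  · refine Finset.sum_congr ?_ fun _ _ => rfl
    ext i
    simp only [Finset.mem_filter, Finset.mem_univ, true_and, Finset.mem_union]
    have := @h i
    tauto
  · rw [Finset.disjoint_filter]
    tauto

lemma classSum_closure_insert (hE : M.E = Set.univ) (v : Fin (n + 1) → ℝ) (i : Fin n) :
    M.classSum S v (M.closure (insert i S)) =
      setSum v (M.closure (insert i S)) - setSum v (M.closure S) := by
  classical
  rw [setSum_sub (M.closure_subset_closure (Set.subset_insert _ _)), classSum, contractNonloops,
    Finset.filter_filter]
  refine Finset.sum_congr (Finset.filter_congr fun j _ => ?_) fun _ _ => rfl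
  constructor
  · rintro ⟨h1, h2⟩
    exact ⟨(mem_closure_insert_iff_of_notMem hE h1).2 h2, h1⟩
  · rintro ⟨h1, h2⟩
    exact ⟨h2, (mem_closure_insert_iff_of_notMem hE h2).1 h1⟩

/-- Descending induction on rank. A line of `M / S` is partitioned into its points. By induction
each point carries the same sum as the whole line, and there are at least two points, so all these
sums are zero. -/
lemma setSum_closure_insert_eq (hE : M.E = Set.univ) (hr : M.eRank = r) {v : Fin (n + 1) → ℝ}
    (hv : ∀ S : Finset (Fin n), M.Indep (S : Set (Fin n)) → S.card + 2 = r →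
      ∀ i, i ∉ M.closure S → setSum v (M.closure (insert i S)) = setSum v (M.closure S)) (m : ℕ) :
    ∀ S : Finset (Fin n), M.Indep (S : Set (Fin n)) → S.card + 2 + m = r →
      ∀ i, i ∉ M.closure S → setSum v (M.closure (insert i S)) = setSum v (M.closure S) := by
  classical
  induction m with
  | zero => exact hv
  | succ m ih =>
    intro S hS hSr i hi
    obtain ⟨hiS, hiI⟩ := (indep_insert_iff hE hS).2 hi
    have hiS' : i ∉ S := hiS
    have hiI' : M.Indep (insert i S : Finset (Fin n)) := by simpa using hiI
    obtain ⟨I, hI, hSI, hIr⟩ := exists_finset_indep_superset (d := S.card + 2) hr hiI'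
      (by rw [Finset.card_insert_of_notMem hiS']; omega) (by omega)
    obtain ⟨j, hjI, hj⟩ := Finset.exists_mem_notMem_of_card_lt_card (s := insert i S) (t := I)
      (by rw [Finset.card_insert_of_notMem hiS']; omega)
    have hj' : j ∉ M.closure (insert i (S : Set (Fin n))) := by
      refine (indep_insert_iff hE hiI).1 ⟨by simpa using hj, hI.subset ?_⟩
      intro x hx
      rcases hx with rfl | hx
      · exact hjI
      · exact hSI (by simpa using hx)
    have hjS : j ∉ M.closure S := fun h =>
      hj' (M.closure_subset_closure (Set.subset_insert _ _) h)
    have hsub : ∀ X : Set (Fin n), X ⊆ M.E := fun X => by rw [hE]; exact Set.subset_univ _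
    set L := M.closure (insert j (insert i (S : Set (Fin n)))) with hL
    have hSL : M.closure S ⊆ L := M.closure_subset_closure
      ((Set.subset_insert _ _).trans (Set.subset_insert _ _))
    have hiL : i ∈ L := M.mem_closure_of_mem (by simp) (hsub _)
    have hjL : j ∈ L := M.mem_closure_of_mem (by simp) (hsub _)
    have hline : ∀ l ∈ L, l ∉ M.closure S → setSum v (M.closure (insert l S)) = setSum v L := by
      intro l hl hlS
      obtain ⟨hlS', hlI⟩ := (indep_insert_iff hE hS).2 hlS
      have hlS'' : l ∉ S := hlS'
      -- The line is spanned by `l` and one of `j`, `i`, according to whether `l` is parallel to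
      -- `i`.
      obtain ⟨x, hx, hxL⟩ : ∃ x, x ∉ M.closure (insert l (S : Set (Fin n))) ∧
          M.closure (insert x (insert l (S : Set (Fin n)))) = L := by
        by_cases hli : l ∈ M.closure (insert i (S : Set (Fin n)))
        · have heq := (mem_closure_insert_iff_of_notMem hE hlS).1 hli
          exact ⟨j, by rwa [heq], M.closure_insert_congr_right heq⟩
        · refine ⟨i, fun h => hli ?_, ?_⟩
          · rw [(mem_closure_insert_iff_of_notMem hE hi).1 h]
            exact M.mem_closure_of_mem (Set.mem_insert _ _) (hsub _)
          · rw [Set.insert_comm]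
            exact M.closure_insert_congr ⟨hl, hli⟩
      have := ih (insert l S) (by simpa using hlI)
        (by rw [Finset.card_insert_of_notMem hlS'']; omega) x (by simpa using hx)
      rw [← hxL, eq_comm]
      simpa using this
    set W : Finset (Fin n) := Finset.univ.filter fun l => l ∈ L ∧ l ∉ M.closure S with hW
    set φ : Fin n → Set (Fin n) := fun l => M.closure (insert l S) with hφ
    have hsum : setSum v L - setSum v (M.closure S) =
        (W.image φ).card * (setSum v L - setSum v (M.closure S)) := by
      nth_rewrite 1 [setSum_sub hSL]
      rw [← nsmul_eq_mul, ← Finset.sum_const, ← Finset.sum_fiberwise_of_maps_to (s := W)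
        (t := W.image φ) (g := φ) fun i hi => Finset.mem_image_of_mem φ hi]
      refine Finset.sum_congr rfl fun p hp => ?_
      obtain ⟨l, hl, rfl⟩ := Finset.mem_image.1 hp
      obtain ⟨hlL, hlS⟩ := (Finset.mem_filter.1 hl).2
      rw [← hline l hlL hlS, setSum_sub (M.closure_subset_closure (Set.subset_insert _ _)), hW,
        Finset.filter_filter]
      refine Finset.sum_congr (Finset.filter_congr fun x _ => ?_) fun _ _ => rfl
      constructor
      · rintro ⟨⟨-, h1⟩, h2⟩
        exact ⟨(mem_closure_insert_iff_of_notMem hE h1).2 h2, h1⟩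
      · rintro ⟨h1, h2⟩
        refine ⟨⟨?_, h2⟩, (mem_closure_insert_iff_of_notMem hE h2).1 h1⟩
        refine M.closure_subset_closure_of_subset_closure ?_ h1
        exact Set.insert_subset hlL ((M.subset_closure _ (hsub _)).trans hSL)
    have hcard : 1 < (W.image φ).card := by
      refine Finset.one_lt_card.2 ⟨φ i, Finset.mem_image_of_mem _ (by simp [hW, hiL, hi]), φ j,
        Finset.mem_image_of_mem _ (by simp [hW, hjL, hjS]), fun h => hj' ?_⟩
      exact (mem_closure_insert_iff_of_notMem hE hjS).2 h.symm
    have hcard' : (1 : ℝ) < (W.image φ).card := by exact_mod_cast hcard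
    have hd : setSum v L - setSum v (M.closure S) = 0 := by
      have h : ((W.image φ).card - 1 : ℝ) * (setSum v L - setSum v (M.closure S)) = 0 := by
        linarith
      exact (mul_eq_zero.1 h).resolve_left (by linarith)
    rw [hline i hiL hi]
    linarith

lemma IsSimple.closure_empty (hM : M.IsSimple) : M.closure ∅ = ∅ := by
  rw [Set.eq_empty_iff_forall_notMem]
  exact hM.1

lemma IsSimple.closure_singleton (hE : M.E = Set.univ) (hM : M.IsSimple) (i : Fin n) :
    M.closure {i} = {i} := by
  have hsub : ∀ X : Set (Fin n), X ⊆ M.E := fun X => by rw [hE]; exact Set.subset_univ _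
  refine Set.Subset.antisymm (fun j hj => ?_) (M.subset_closure _ (hsub _))
  by_contra hij
  have hi : M.Indep {i} := by
    by_contra h
    exact hM.1 i ((M.singleton_not_indep (hsub {i} rfl)).1 h)
  have hdep : M.Dep {i, j} := by
    rw [Set.pair_comm]
    exact (hi.insert_dep_iff).2 ⟨hj, hij⟩
  obtain ⟨C, hC, hCc⟩ := hdep.exists_isCircuit_subset
  rcases Set.subset_pair_iff_eq.1 hC with rfl | rfl | rfl | rfl
  · exact hCc.nonempty.ne_empty rfl
  · exact hM.1 _ (singleton_isCircuit.1 hCc)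
  · exact hM.1 _ (singleton_isCircuit.1 hCc)
  · exact hM.2 i j (fun h => hij h.symm) hCc

/-- With `v_0 = 0` the class sums vanish at size `r - 2`. Descending to `S = ∅`, where the points of
a simple matroid are singletons, isolates each coordinate. -/
lemma eq_zero_of_hessianAt_mulVec_eq_zero (hE : M.E = Set.univ) (hM : M.IsSimple)
    (hr : M.eRank = r) (h2 : 2 ≤ r) (h0 : 0 ≤ a 0) (ha : ∀ i : Fin n, 0 < a i.succ)
    {v : Fin (n + 1) → ℝ} (hv : (M.indepPolyDeriv ∅ (n - r)).hessianAt a *ᵥ v = 0)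
    (hv0 : v 0 = 0) : v = 0 := by
  classical
  have hrn := rank_le hr
  have hbase : ∀ S : Finset (Fin n), M.Indep (S : Set (Fin n)) → S.card + 2 = r →
      ∀ i, i ∉ M.closure S → setSum v (M.closure (insert i S)) = setSum v (M.closure S) := by
    intro S hS hSr i hi
    have hc := (classSum_of_hessianAt_mulVec_eq_zero hE hS (by omega : S.card + (n - r + 2) = n)
      (dotProduct_hessianAt_mulVec_pos hr hS (by omega) (m := 0) (by omega) h0 ha)
      (hessianAt_mulVec_eq_zero_of_empty hE hr h0 ha hv hS (by omega))).1
      (M.closure (insert i S)) (Finset.mem_image_of_mem _ (mem_contractNonloops.2 hi))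
    rw [hv0, add_zero, classSum_closure_insert hE] at hc
    linarith
  ext i
  refine Fin.cases hv0 (fun i => ?_) i
  have h := setSum_closure_insert_eq hE hr hbase (r - 2) ∅ (by simp)
    (by rw [Finset.card_empty]; omega) i
    (by rw [Finset.coe_empty, hM.closure_empty]; exact Set.notMem_empty i)
  rw [Finset.coe_empty, insert_empty_eq, hM.closure_singleton hE, hM.closure_empty] at h
  simpa [setSum, Finset.sum_filter] using h

theorem hasLorentzianSignature_reducedIndepPoly (hE : M.E = Set.univ) (hM : M.IsSimple)
    (hr : M.eRank = r) (h2 : 2 ≤ r) (hU : ¬ M.IsUniform) (h0 : 0 ≤ a 0)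
    (ha : ∀ i : Fin n, 0 < a i.succ) :
    ((M.reducedIndepPoly ℝ).hessianAt a).HasLorentzianSignature := by
  have hrn := rank_le hr
  obtain ⟨m, rfl⟩ : ∃ m, r = m + 2 := ⟨r - 2, by omega⟩
  rw [reducedIndepPoly_eq, hr, ENat.toNat_natCast]
  have hk : (∅ : Finset (Fin n)).card + (n - (m + 2)) + (m + 2) = n := by
    rw [Finset.card_empty]; omega
  refine (reverseCS_hessianAt hE h0 ha hk).hasLorentzianSignature (isSymm_hessianAt _ _)
    (dotProduct_hessianAt_mulVec_pos hr (by simp) (by omega) hk h0 ha) fun v hv => ?_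
  exact eq_zero_of_hessianAt_mulVec_eq_zero hE hM hr h2 h0 ha hv
    (apply_zero_eq_zero_of_not_isUniform hE hr h2 hU h0 ha hv)

end Matroid
end

/-! ### The basis generating polynomial and strict log-concavity -/

noncomputable section

open Matrix MvPolynomial

namespace MvPolynomial

variable {n : ℕ}

/-- The substitution `x_0 = 0`, followed by a shift of the other variables. -/
def evalZero (n : ℕ) : MvPolynomial (Fin (n + 1)) ℝ →ₐ[ℝ] MvPolynomial (Fin n) ℝ :=
  aeval (Fin.cons 0 X)

lemma evalZero_X_zero : evalZero n (X 0) = 0 := by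
  simp [evalZero]

lemma evalZero_X_succ (i : Fin n) : evalZero n (X i.succ) = X i := by
  simp [evalZero]

lemma eval_evalZero (p : MvPolynomial (Fin (n + 1)) ℝ) (a : Fin n → ℝ) :
    eval a (evalZero n p) = eval (Fin.cons 0 a) p := by
  induction p using MvPolynomial.induction_on with
  | C c => simp [evalZero]
  | add p q hp hq => simp only [map_add, hp, hq]
  | mul_X p i hp =>
    simp only [map_mul, hp, eval_X]
    congr 1
    refine Fin.cases ?_ (fun i => ?_) i
    · simp [evalZero_X_zero]
    · simp [evalZero_X_succ]

lemma pderiv_evalZero (i : Fin n) (p : MvPolynomial (Fin (n + 1)) ℝ) :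
    pderiv i (evalZero n p) = evalZero n (pderiv i.succ p) := by
  classical
  induction p using MvPolynomial.induction_on with
  | C c => simp [evalZero]
  | add p q hp hq => simp only [map_add, hp, hq]
  | mul_X p j hp =>
    simp only [map_mul, pderiv_mul, map_add, hp]
    congr 2
    refine Fin.cases ?_ (fun j => ?_) j
    · rw [evalZero_X_zero, pderiv_X_of_ne (Fin.succ_ne_zero i).symm, map_zero, map_zero]
    · rw [evalZero_X_succ, pderiv_X, pderiv_X]
      by_cases h : i = j <;> simp [h]

lemma dotProduct_hessianAt_evalZero_mulVec (p : MvPolynomial (Fin (n + 1)) ℝ)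
    (a v w : Fin n → ℝ) :
    v ⬝ᵥ (evalZero n p).hessianAt a *ᵥ w =
      (Fin.cons 0 v : Fin (n + 1) → ℝ) ⬝ᵥ p.hessianAt (Fin.cons 0 a) *ᵥ Fin.cons 0 w := by
  simp [dotProduct, mulVec, Fin.sum_univ_succ, hessianAt_apply, pderiv_evalZero, eval_evalZero]

lemma dotProduct_hessianAt_C_mul_mulVec {ι : Type*} [Fintype ι] (c : ℝ) (p : MvPolynomial ι ℝ)
    (a v w : ι → ℝ) :
    v ⬝ᵥ (C c * p).hessianAt a *ᵥ w = c * (v ⬝ᵥ p.hessianAt a *ᵥ w) := by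
  have : (C c * p).hessianAt a = c • p.hessianAt a := by
    ext i j
    simp [hessianAt_apply]
  rw [this, smul_mulVec, dotProduct_smul, smul_eq_mul]

lemma hasDerivAt_eval_add_smul {ι : Type*} [Fintype ι] (p : MvPolynomial ι ℝ) (x v : ι → ℝ)
    (t : ℝ) : HasDerivAt (fun t : ℝ => eval (x + t • v) p)
      (∑ i, v i * eval (x + t • v) (pderiv i p)) t := by
  classical
  induction p using MvPolynomial.induction_on with
  | C c => simpa using hasDerivAt_const t c
  | add p q hp hq =>
    simp only [map_add, mul_add, Finset.sum_add_distrib]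
    exact hp.add hq
  | mul_X p j hp =>
    have hX : HasDerivAt (fun t : ℝ => eval (x + t • v) (X j : MvPolynomial ι ℝ)) (v j) t := by
      simpa using ((hasDerivAt_id t).mul_const (v j)).const_add (x j)
    have := hp.mul hX
    simp only [map_mul]
    refine this.congr_deriv ?_
    simp only [pderiv_mul, map_add, map_mul, mul_add, Finset.sum_add_distrib, Finset.sum_mul,
      pderiv_X]
    congr 1
    · exact Finset.sum_congr rfl fun i _ => by ring
    · rw [Finset.sum_eq_single j]
      · simp; ring
      · intro i _ hij
        simp [hij.symm]
      · simp

lemma sum_mul_sum_mul_eval_pderiv {ι : Type*} [Fintype ι] (p : MvPolynomial ι ℝ) (a v : ι → ℝ) :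
    ∑ i, v i * ∑ j, v j * eval a (pderiv j (pderiv i p)) = v ⬝ᵥ p.hessianAt a *ᵥ v := by
  simp only [dotProduct, mulVec]
  refine Finset.sum_congr rfl fun i _ => ?_
  congr 1
  refine Finset.sum_congr rfl fun j _ => ?_
  rw [hessianAt_apply, pderiv_comm, mul_comm]

/-- A homogeneous polynomial of degree at least two that is positive on the positive orthant is
strictly log-concave there if its Hessians are nondegenerate and satisfy the reverse Cauchy–Schwarz
inequality. -/
theorem IsHomogeneous.strictlyLogConcaveOn {ι : Type*} [Fintype ι] {p : MvPolynomial ι ℝ} {m : ℕ}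
    (hp : p.IsHomogeneous (m + 2)) (hpos : ∀ a : ι → ℝ, (∀ i, 0 < a i) → 0 < eval a p)
    (hcs : ∀ a : ι → ℝ, (∀ i, 0 < a i) → (p.hessianAt a).ReverseCS a)
    (hker : ∀ a : ι → ℝ, (∀ i, 0 < a i) → ∀ v, p.hessianAt a *ᵥ v = 0 → v = 0) :
    p.StrictlyLogConcaveOn {x | ∀ i, 0 < x i} := by
  have hconv : Convex ℝ {x : ι → ℝ | ∀ i, 0 < x i} := by
    intro x hx y hy s t hs ht hst i
    have h1 := hx i
    have h2 := hy i
    simp only [Pi.add_apply, Pi.smul_apply, smul_eq_mul]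
    rcases hs.eq_or_lt with rfl | hs'
    · have : t = 1 := by linarith
      subst this
      linarith
    · have := mul_pos hs' h1
      have := mul_nonneg ht h2.le
      linarith
  refine ⟨hpos, hconv, fun x hx y hy hxy s t hs ht hst => ?_⟩
  set v := y - x with hv
  have hv0 : v ≠ 0 := sub_ne_zero.2 hxy.symm
  have hline : ∀ u ∈ Set.Icc (0 : ℝ) 1, ∀ i, 0 < (x + u • v) i := by
    intro u hu
    have h := hconv hx hy (sub_nonneg.2 hu.2) hu.1 (by ring)
    have he : x + u • v = (1 - u) • x + u • y := by rw [hv]; module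
    rw [he]
    exact h
  set h : ℝ → ℝ := fun u => eval (x + u • v) p with hh
  set h' : ℝ → ℝ := fun u => ∑ i, v i * eval (x + u • v) (pderiv i p) with hh'
  have hd : ∀ u, HasDerivAt h (h' u) u := fun u => hasDerivAt_eval_add_smul p x v u
  have hd' : ∀ u, HasDerivAt h' (v ⬝ᵥ p.hessianAt (x + u • v) *ᵥ v) u := fun u => by
    rw [← sum_mul_sum_mul_eval_pderiv]
    exact HasDerivAt.fun_sum fun i _ => (hasDerivAt_eval_add_smul (pderiv i p) x v u).const_mul _
  have hhpos : ∀ u ∈ Set.Icc (0 : ℝ) 1, 0 < h u := fun u hu => hpos _ (hline u hu)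
  -- Equivalent to `(log h)'' < 0`. If `h' ≠ 0`, strictness comes from the factor `(m + 1)/(m + 2)`
  -- in reverse Cauchy–Schwarz; if `h' = 0`, then `v` is orthogonal to the base point and
  -- nondegeneracy gives `h'' < 0`.
  have hkey : ∀ u ∈ Set.Icc (0 : ℝ) 1,
      (v ⬝ᵥ p.hessianAt (x + u • v) *ᵥ v) * h u < h' u ^ 2 := by
    intro u hu
    have ha := hline u hu
    have hp0 := hhpos u hu
    have hcs' := hcs _ ha
    have hav : (x + u • v) ⬝ᵥ p.hessianAt (x + u • v) *ᵥ v = (m + 1) * h' u := by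
      rw [(isSymm_hessianAt _ _).dotProduct_mulVec_comm, dotProduct, hh', Finset.mul_sum]
      refine Finset.sum_congr rfl fun i _ => ?_
      rw [hp.hessianAt_mulVec]
      ring
    have haa : (x + u • v) ⬝ᵥ p.hessianAt (x + u • v) *ᵥ (x + u • v) = (m + 1) * (m + 2) * h u :=
      hp.dotProduct_hessianAt_mulVec _
    have haa' : 0 < (x + u • v) ⬝ᵥ p.hessianAt (x + u • v) *ᵥ (x + u • v) := by
      rw [haa]; positivity
    by_cases h0 : h' u = 0
    · rw [h0] at hav ⊢
      rw [mul_zero] at hav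
      have hneg : v ⬝ᵥ p.hessianAt (x + u • v) *ᵥ v < 0 :=
        lt_of_le_of_ne (hcs'.nonpos haa' hav) fun h => hv0 (hker _ ha v
          (hcs'.mulVec_eq_zero (isSymm_hessianAt _ _) haa' hav h))
      nlinarith
    · have h1 := hcs' v
      rw [hav, haa] at h1
      have h2 : 0 < h' u ^ 2 := by positivity
      have hm : (0 : ℝ) < m + 1 := by positivity
      set Z := v ⬝ᵥ p.hessianAt (x + u • v) *ᵥ v
      have h3 : (m + 2) * (Z * h u) ≤ (m + 1) * h' u ^ 2 := by
        refine le_of_mul_le_mul_left ?_ hm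
        nlinarith
      by_contra hcon
      push Not at hcon
      nlinarith
  have hconc : StrictConcaveOn ℝ (Set.Icc (0 : ℝ) 1) fun u => Real.log (h u) := by
    refine strictConcaveOn_of_deriv2_neg (convex_Icc 0 1) ?_ fun u hu => ?_
    · intro u hu
      exact ((hd u).log (hhpos u hu).ne').continuousAt.continuousWithinAt
    · rw [interior_Icc] at hu
      have h1 : deriv (fun u => Real.log (h u)) =ᶠ[nhds u] fun u => h' u / h u := by
        filter_upwards [isOpen_Ioo.mem_nhds hu] with w hw
        exact ((hd w).log (hhpos w (Set.Ioo_subset_Icc_self hw)).ne').deriv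
      have hu' := Set.Ioo_subset_Icc_self hu
      have hu0 := hhpos u hu'
      rw [Function.iterate_succ_apply, Function.iterate_one, h1.deriv_eq,
        ((hd' u).fun_div (hd u) hu0.ne').deriv]
      refine div_neg_of_neg_of_pos ?_ (by positivity)
      have := hkey u hu'
      nlinarith
  have := hconc.2 (Set.left_mem_Icc.2 zero_le_one) (Set.right_mem_Icc.2 zero_le_one) zero_ne_one
    hs ht hst
  have e0 : h 0 = eval x p := by simp [hh]
  have e1 : h 1 = eval y p := by simp [hh, hv]
  have et : h (s • 0 + t • 1) = eval (s • x + t • y) p := by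
    simp only [hh]
    congr 2
    ext i
    simp only [smul_eq_mul, mul_zero, mul_one, zero_add, hv, Pi.add_apply, Pi.smul_apply,
      Pi.sub_apply]
    have : s = 1 - t := by linarith
    rw [this]
    ring
  simpa only [e0, e1, et] using this

end MvPolynomial

namespace Matroid

variable {n r : ℕ} {M : Matroid (Fin n)} {a : Fin n → ℝ}

/-- A non-basis has fewer than `r` elements, so its term retains a positive power of `x_0` and dies;
each basis contributes the factor `(n - r)!`. -/
lemma evalZero_indepPolyDeriv (hr : M.eRank = r) :
    evalZero n (M.indepPolyDeriv ∅ (n - r)) =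
      C (((n - r).factorial : ℕ) : ℝ) * M.basisPoly ℝ := by
  classical
  have hrn := rank_le hr
  rw [indepPolyDeriv, map_sum, basisPoly, Finset.mul_sum]
  symm
  refine Finset.sum_subset_zero_on_sdiff (fun I hI => ?_) (fun I hI => ?_) fun I hI => ?_
  · exact Finset.mem_filter.2 ⟨Finset.mem_univ _, (Finset.mem_filter.1 hI).2.indep, by simp⟩
  · obtain ⟨h1, h2⟩ := Finset.mem_sdiff.1 hI
    have hI' := (Finset.mem_filter.1 h1).2.1
    obtain ⟨B, hB, hIB, hBr⟩ := exists_finset_isBase_superset hr hI'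
    have hne : I ≠ B := by
      rintro rfl
      exact h2 (Finset.mem_filter.2 ⟨Finset.mem_univ _, hB⟩)
    have := Finset.card_lt_card (hIB.ssubset_of_ne hne)
    rw [map_mul, map_mul, map_pow, evalZero_X_zero, zero_pow (by omega)]
    simp
  · have hI' := (Finset.mem_filter.1 hI).2
    have hIr : I.card = r := by
      have := hI'.encard_eq_eRank
      rw [hr, Set.encard_coe_eq_coe_finsetCard] at this
      exact_mod_cast this
    rw [hIr, Nat.descFactorial_self]
    simp [evalZero]

lemma dotProduct_hessianAt_basisPoly_mulVec (hr : M.eRank = r) (v w : Fin n → ℝ) :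
    ((n - r).factorial : ℝ) * (v ⬝ᵥ (M.basisPoly ℝ).hessianAt a *ᵥ w) =
      (Fin.cons 0 v : Fin (n + 1) → ℝ) ⬝ᵥ
        (M.indepPolyDeriv ∅ (n - r)).hessianAt (Fin.cons 0 a) *ᵥ Fin.cons 0 w := by
  rw [← dotProduct_hessianAt_evalZero_mulVec, evalZero_indepPolyDeriv hr,
    dotProduct_hessianAt_C_mul_mulVec]

lemma isHomogeneous_basisPoly (hr : M.eRank = r) : (M.basisPoly ℝ).IsHomogeneous r := by
  classical
  refine IsHomogeneous.sum _ _ _ fun B hB => ?_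
  have hBr : B.card = r := by
    have := (Finset.mem_filter.1 hB).2.encard_eq_eRank
    rw [hr, Set.encard_coe_eq_coe_finsetCard] at this
    exact_mod_cast this
  have h : (∏ i ∈ B, (X i : MvPolynomial (Fin n) ℝ)).IsHomogeneous (∑ i ∈ B, 1) :=
    IsHomogeneous.prod _ _ _ fun i _ => isHomogeneous_X _ _
  rwa [Finset.sum_const, smul_eq_mul, mul_one, hBr] at h

lemma eval_basisPoly_pos (hr : M.eRank = r) (ha : ∀ i, 0 < a i) :
    0 < eval a (M.basisPoly ℝ) := by
  classical
  obtain ⟨B, hB, -, -⟩ := exists_finset_isBase_superset (S := ∅) hr (by simp)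
  rw [basisPoly, map_sum]
  refine Finset.sum_pos (fun B _ => ?_) ⟨B, Finset.mem_filter.2 ⟨Finset.mem_univ _, hB⟩⟩
  rw [map_prod]
  exact Finset.prod_pos fun i _ => by rw [eval_X]; exact ha i

lemma reverseCS_hessianAt_basisPoly (hE : M.E = Set.univ) (hr : M.eRank = r) (h2 : 2 ≤ r)
    (ha : ∀ i, 0 < a i) : ((M.basisPoly ℝ).hessianAt a).ReverseCS a := by
  intro v
  have hrn := rank_le hr
  have hcs := reverseCS_hessianAt (S := ∅) (k := n - r) (m := r - 2) (a := Fin.cons 0 a) hE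
    le_rfl (by simpa using ha) (by rw [Finset.card_empty]; omega) (Fin.cons 0 v)
  simp only [← dotProduct_hessianAt_basisPoly_mulVec hr] at hcs
  have hf : (0 : ℝ) < (n - r).factorial := by exact_mod_cast (n - r).factorial_pos
  refine le_of_mul_le_mul_left ?_ (mul_pos hf hf)
  nlinarith

/-- The lift `(0, v)` is a priori only null and orthogonal to `(0, a)`. The equality case of reverse
Cauchy–Schwarz puts it in the kernel of the larger Hessian, and its zeroth coordinate vanishes by
construction. -/
lemma eq_zero_of_hessianAt_basisPoly_mulVec_eq_zero (hE : M.E = Set.univ) (hM : M.IsSimple)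
    (hr : M.eRank = r) (h2 : 2 ≤ r) (ha : ∀ i, 0 < a i) {v : Fin n → ℝ}
    (hv : (M.basisPoly ℝ).hessianAt a *ᵥ v = 0) : v = 0 := by
  have hrn := rank_le hr
  have ha' : ∀ i : Fin n, 0 < (Fin.cons 0 a : Fin (n + 1) → ℝ) i.succ := by simpa using ha
  have hk : (∅ : Finset (Fin n)).card + (n - r) + (r - 2 + 2) = n := by
    rw [Finset.card_empty]; omega
  have h0 : (0 : ℝ) ≤ (Fin.cons 0 a : Fin (n + 1) → ℝ) 0 := le_rfl
  have hQ : (M.indepPolyDeriv ∅ (n - r)).hessianAt (Fin.cons 0 a) *ᵥ Fin.cons 0 v = 0 := by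
    refine (reverseCS_hessianAt hE h0 ha' hk).mulVec_eq_zero (isSymm_hessianAt _ _)
      (dotProduct_hessianAt_mulVec_pos hr (by simp) (by omega) hk h0 ha') ?_ ?_
    all_goals rw [← dotProduct_hessianAt_basisPoly_mulVec hr, hv, dotProduct_zero, mul_zero]
  have := eq_zero_of_hessianAt_mulVec_eq_zero hE hM hr h2 h0 ha' hQ (Fin.cons_zero _ _)
  ext i
  simpa using congrFun this i.succ

theorem hasLorentzianSignature_basisPoly (hE : M.E = Set.univ) (hM : M.IsSimple)
    (hr : M.eRank = r) (h2 : 2 ≤ r) (ha : ∀ i, 0 < a i) :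
    ((M.basisPoly ℝ).hessianAt a).HasLorentzianSignature := by
  refine (reverseCS_hessianAt_basisPoly hE hr h2 ha).hasLorentzianSignature (isSymm_hessianAt _ _)
    ?_ fun v hv => eq_zero_of_hessianAt_basisPoly_mulVec_eq_zero hE hM hr h2 ha hv
  obtain ⟨m, rfl⟩ : ∃ m, r = m + 2 := ⟨r - 2, by omega⟩
  rw [(isHomogeneous_basisPoly hr).dotProduct_hessianAt_mulVec]
  have := eval_basisPoly_pos hr ha
  positivity

theorem strictlyLogConcaveOn_basisPoly (hE : M.E = Set.univ) (hM : M.IsSimple)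
    (hr : M.eRank = r) (h2 : 2 ≤ r) :
    (M.basisPoly ℝ).StrictlyLogConcaveOn {x : Fin n → ℝ | ∀ i, 0 < x i} := by
  obtain ⟨m, rfl⟩ : ∃ m, r = m + 2 := ⟨r - 2, by omega⟩
  exact (isHomogeneous_basisPoly hr).strictlyLogConcaveOn (fun a ha => eval_basisPoly_pos hr ha)
    (fun a ha => reverseCS_hessianAt_basisPoly hE hr h2 ha)
    fun a ha v hv => eq_zero_of_hessianAt_basisPoly_mulVec_eq_zero hE hM hr h2 ha hv

end Matroid
end

theorem theorem1p1 (n : ℕ) (M : Matroid (Fin n)) (hE : M.E = Set.univ) (hM : M.IsSimple)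
    (hr : 2 ≤ M.eRank) :
    ((∀ a : Fin n → ℝ, (∀ i, 0 < a i) →
        ((M.basisPoly ℝ).hessianAt a).HasLorentzianSignature) ∧
      (M.basisPoly ℝ).StrictlyLogConcaveOn {x : Fin n → ℝ | ∀ i, 0 < x i}) ∧
    (¬ M.IsUniform → ∀ a : Fin (n + 1) → ℝ, 0 ≤ a 0 → (∀ i : Fin n, 0 < a i.succ) →
      ((M.reducedIndepPoly ℝ).hessianAt a).HasLorentzianSignature) := by
  obtain ⟨r, hr'⟩ : ∃ r : ℕ, M.eRank = r :=
    ⟨M.eRank.toNat, (ENat.natCast_toNat (M.eRank_ne_top_iff.2 inferInstance)).symm⟩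
  have h2 : 2 ≤ r := by
    rw [hr'] at hr
    exact_mod_cast hr
  exact ⟨⟨fun a ha => Matroid.hasLorentzianSignature_basisPoly hE hM hr' h2 ha,
    Matroid.strictlyLogConcaveOn_basisPoly hE hM hr' h2⟩,
    fun hU a h0 ha => Matroid.hasLorentzianSignature_reducedIndepPoly hE hM hr' h2 hU h0 ha⟩
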